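/- **Conventions.** A language $L$ is a set of function and relation symbols with arities. An $L$-structure $\mathcal M$ is a complete metric space $|\mathcal M|$ with a continuous map $R^{\mathcal M}\colon|\mathcal M|^n\to\mathbb R$ for each $n$-ary relation symbol $R$ and a continuous map $f^{\mathcal M}\colon|\mathcal M|^n\to|\mathcal M|$ for each $n$-ary function symbol $f$. An $L$-embedding is an isometry that preserves all symbols. $\langle E\rangle$ denotes the smallest closed subset of $|\mathcal M|$ containing $E$ and closed under the functions; $E$ is a generator of $\mathcal M$ if $\langle E\rangle=\mathcal M$. Let $\mathscr K$ be a category of finitely generated $L$-structures and (some) $L$-embeddings, whose morphisms are called $\mathscr K$-embeddings. *Approximate isometries.* For metric spaces $X,Y$, $\operatorname{Apx}(X,Y)$ is the set of maps $\varphi\colon X\times Y\to[0,\infty]$ that satisfy $\varphi(x)\le d(x,x')+\varphi(x')$ and $d(x,x')\le\varphi(x)+\varphi(x')$ in each variable separately, with the topology of pointwise convergence and the pointwise order. Write $\psi\vartriangleleft\varphi$ if $\psi$ is in the interior of $\{\chi\in\operatorname{Apx}(X,Y)\mid\chi\le\varphi\}$. For isometries $\iota\colon X\to Z$, $\eta\colon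 Y\to Z$ put $\varphi_{\iota,\eta}(x,y)=d(\iota(x),\eta(y))$, and $\varphi_\iota=\varphi_{\iota,\mathrm{id}}$. If $X,Y$ are embedded isometrically in $X',Y'$, the trivial extension of $\varphi\in\operatorname{Apx}(X,Y)$ is $\varphi|^{X'\times Y'}(x',y')=\inf_{x\in X,\,y\in Y}\bigl(d(x',x)+\varphi(x,y)+d(y,y')\bigr)$. *Approximate $\mathscr K$-isomorphisms.* For objects $\mathcal A,\mathcal B$, a finite partial $\mathscr K$-isomorphism $\iota\colon\mathcal A\dashrightarrow\mathcal B$ is an isometry from a finite subset of $|\mathcal A|$ onto a finite subset of $|\mathcal B|$ such that $\langle\operatorname{dom}\iota\rangle$ and $\langle\operatorname{ran}\iota\rangle$ are the images of $\mathscr K$-embeddings $i\colon\mathcal D\to\mathcal A$ and $j\colon\mathcal D'\to\mathcal B$ and $\iota$ is induced by a $\mathscr K$-isomorphism $e\colon\mathcal D\to\mathcal D'$, i.e. $\iota(i(d))=j(e(d))$ whenever $i(d)\in\operatorname{dom}\iota$. $\operatorname{Apx}_{2,\mathscr K}(\mathcal A,\mathcal B)$ is the set of all $\varphi_{\iota,\eta}|^{\mathcal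 A\times\mathcal B}$ with finite partial $\mathscr K$-isomorphisms $\iota\colon\mathcal A\dashrightarrow\mathcal C$, $\eta\colon\mathcal B\dashrightarrow\mathcal C$ into some object $\mathcal C$. A $\mathscr K$-structure is an $L$-structure $\mathcal M$ together with a sequence $\mathcal A_1\to\mathcal A_2\to\cdots$ of $\mathscr K$-embeddings whose inductive limit is $\mathcal M$, written $\mathcal M=\overline{\bigcup_n\mathcal A_n}$; objects are regarded as $\mathscr K$-structures via constant sequences. For $\mathcal M=\overline{\bigcup_n\mathcal A_n}$ and $\mathcal N=\overline{\bigcup_m\mathcal B_m}$, $$\operatorname{Apx}_{\mathscr K}(\mathcal M,\mathcal N)=\operatorname{cl}\Bigl(\bigcup_{n,m}\{\psi\mid\exists\varphi\in\operatorname{Apx}_{2,\mathscr K}(\mathcal A_n,\mathcal B_m),\ \psi\ge\varphi|^{\mathcal M\times\mathcal N}\}\Bigr),$$ and $\operatorname{Stx}_{\mathscr K}(\mathcal M,\mathcal N)$ is the set of $\varphi\in\operatorname{Apx}_{\mathscr K}(\mathcal M,\mathcal N)$ such that $\psi\vartriangleleft\varphi$ for some $\psi\in\operatorname{Apx}_{\mathscr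 K}(\mathcal M,\mathcal N)$. An $L$-embedding $\iota\colon\mathcal M\to\mathcal N$ is $\mathscr K$-admissible if $\varphi_\iota\in\operatorname{Apx}_{\mathscr K}(\mathcal M,\mathcal N)$. *Fraïssé categories.* $\mathscr K_n$ is the class of pairs $\langle\mathcal A,\bar a\rangle$ of an object $\mathcal A$ and $\bar a\in|\mathcal A|^n$ whose entries generate $\mathcal A$, with $$d^{\mathscr K}(\langle\mathcal A,\bar a\rangle,\langle\mathcal B,\bar b\rangle)=\inf\{\max_i\varphi(a_i,b_i)\mid\varphi\in\operatorname{Apx}_{\mathscr K}(\mathcal A,\mathcal B)\}.$$ $\mathscr K$ is a Fraïssé category if all its objects are separable and it satisfies - JEP: any two objects have $\mathscr K$-embeddings into a common object; - NAP: for $\mathscr K$-embeddings $\iota_i\colon\mathcal A\to\mathcal B_i$ ($i=1,2$), finite $F\subseteq|\mathcal A|$ and $\varepsilon>0$ there are $\mathscr K$-embeddings $\eta_i\colon\mathcal B_i\to\mathcal C$ into a common object with $d(\eta_1\iota_1(a),\eta_2\iota_2(a))<\varepsilon$ for all $a\in F$; - WPP: every $(\mathscr K_n,d^{\mathscr K})$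 is separable; - CCP: for every $n$-ary relation symbol $P$, every $n$-ary function symbol $f$ and every $m$, the maps $\langle\mathcal A,(\bar a,\bar b)\rangle\mapsto P^{\mathcal A}(\bar a)$ from $\mathscr K_{n+m}$ to $\mathbb R$ and $\langle\mathcal A,(\bar a,\bar b)\rangle\mapsto\langle\mathcal A,(\bar a,\bar b,f^{\mathcal A}(\bar a))\rangle$ from $\mathscr K_{n+m}$ to $\mathscr K_{n+m+1}$ send Cauchy sequences to Cauchy sequences. A $\mathscr K$-structure $\mathcal M$ is a Fraïssé limit of $\mathscr K$ if for every $\mathscr K$-structure $\mathcal N$ and every $\varphi\in\operatorname{Stx}_{\mathscr K}(\mathcal N,\mathcal M)$ there is a $\mathscr K$-admissible embedding $\iota\colon\mathcal N\to\mathcal M$ with $\varphi_\iota\vartriangleleft\varphi$. **Theorem.** Let $\mathscr K$ be a Fraïssé category with at least one object, in which every inductive sequence of $\mathscr K$-embeddings has an inductive limit that is an $L$-structure. Then $\mathscr K$ has a Fraïssé limit. -/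

import Mathlib

open Set Topology
open scoped ENNReal

universe u v w x

/-! ## Approximate isometries -/

/-- Katetov maps `X → [0, ∞]`. -/
def IsKatetov {X : Type*} [MetricSpace X] (φ : X → ℝ≥0∞) : Prop :=
  (∀ p q, φ p ≤ edist p q + φ q) ∧ ∀ p q, edist p q ≤ φ p + φ q

/-- Approximate isometries from `X` to `Y`: separately Katetov maps `X × Y → [0, ∞]`.
The topology (pointwise convergence) and the pointwise order are those of a subtype of
`X → Y → [0, ∞]`. -/
def Apx (X Y : Type*) [MetricSpace X] [MetricSpace Y] : Type _ :=
  {φ : X → Y → ℝ≥0∞ // (∀ y, IsKatetov fun p => φ p y) ∧ ∀ p, IsKatetov (φ p)}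

namespace Apx

variable {X Y Z X' Y' : Type*} [MetricSpace X] [MetricSpace Y] [MetricSpace Z]
  [MetricSpace X'] [MetricSpace Y']

instance : TopologicalSpace (Apx X Y) := instTopologicalSpaceSubtype

instance : PartialOrder (Apx X Y) := Subtype.partialOrder _

instance : CoeFun (Apx X Y) fun _ => X → Y → ℝ≥0∞ := ⟨Subtype.val⟩

/-- The approximate isometry `(p, q) ↦ d (ι p, η q)` of a joint embedding `(ι, η)`. -/
def ofJoint (ι : X → Z) (η : Y → Z) (hι : Isometry ι) (hη : Isometry η) : Apx X Y :=
  ⟨fun p q => edist (ι p) (η q),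
    fun q => ⟨fun p p' => by
        have h := edist_triangle (ι p) (ι p') (η q)
        rwa [hι.edist_eq] at h,
      fun p p' => by
        have h := edist_triangle_right (ι p) (ι p') (η q)
        rwa [hι.edist_eq] at h⟩,
    fun p => ⟨fun q q' => by
        have h := edist_triangle_right (ι p) (η q) (η q')
        rw [hη.edist_eq] at h
        rwa [add_comm],
      fun q q' => by
        have h := edist_triangle_left (η q) (η q') (ι p)
        rwa [hη.edist_eq] at h⟩⟩

/-- The approximate isometry `(p, q) ↦ d (ι p, q)` of an isometry `ι`. -/
def graph (ι : X → Y) (hι : Isometry ι) : Apx X Y :=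
  ofJoint ι id hι isometry_id

/-- The adjoint `φ*`. -/
def adj (φ : Apx X Y) : Apx Y X :=
  ⟨fun q p => φ p q, φ.2.2, φ.2.1⟩

/-- The composition `ψφ`, that is `(p, r) ↦ inf_q (φ (p, q) + ψ (q, r))`. -/
noncomputable def comp (ψ : Apx Y Z) (φ : Apx X Y) : Apx X Z :=
  ⟨fun p r => ⨅ q, φ p q + ψ q r,
    fun r => ⟨fun p p' => by
        rw [ENNReal.add_iInf]
        refine iInf_mono fun q => ?_
        rw [← add_assoc]
        gcongr
        exact (φ.2.1 q).1 p p',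
      fun p p' => by
        rw [ENNReal.iInf_add]
        refine le_iInf fun q => ?_
        rw [ENNReal.add_iInf]
        refine le_iInf fun q' => ?_
        calc edist p p' ≤ φ p q + φ p' q := (φ.2.1 q).2 p p'
          _ ≤ φ p q + (edist q q' + φ p' q') := by
            gcongr
            exact (φ.2.2 p').1 q q'
          _ ≤ φ p q + ((ψ q r + ψ q' r) + φ p' q') := by
            gcongr
            exact (ψ.2.1 r).2 q q'
          _ = φ p q + ψ q r + (φ p' q' + ψ q' r) := by ring⟩,
    fun p => ⟨fun r r' => by
        rw [ENNReal.add_iInf]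
        refine iInf_mono fun q => ?_
        calc φ p q + ψ q r ≤ φ p q + (edist r r' + ψ q r') := by
              gcongr
              exact (ψ.2.2 q).1 r r'
          _ = edist r r' + (φ p q + ψ q r') := by ring,
      fun r r' => by
        rw [ENNReal.iInf_add]
        refine le_iInf fun q => ?_
        rw [ENNReal.add_iInf]
        refine le_iInf fun q' => ?_
        calc edist r r' ≤ ψ q r + ψ q r' := (ψ.2.2 q).2 r r'
          _ ≤ ψ q r + (edist q q' + ψ q' r') := by
            gcongr
            exact (ψ.2.1 r').1 q q'
          _ ≤ ψ q r + ((φ p q + φ p q') + ψ q' r') := by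
            gcongr
            exact (φ.2.2 p).2 q q'
          _ = φ p q + ψ q r + (φ p q' + ψ q' r') := by ring⟩⟩

/-- The trivial extension of `φ` from `X × Y` to `X' × Y'` along isometric embeddings
`ι : X → X'` and `η : Y → Y'`, that is `φ_η φ φ_ι*`. -/
noncomputable def trivExt (ι : X → X') (η : Y → Y') (hι : Isometry ι) (hη : Isometry η) (φ : Apx X Y) :
    Apx X' Y' :=
  (graph η hη).comp (φ.comp (graph ι hι).adj)

/-- `φ.StrictlyDominates ψ`: the approximate isometry `ψ` lies in the interior of the set of
all approximate isometries below `φ`, written `ψ ◁ φ`. -/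
def StrictlyDominates (φ ψ : Apx X Y) : Prop :=
  ψ ∈ interior {χ : Apx X Y | χ ≤ φ}

end Apx

/-! ## Metric structures

The symbols of a language with their arities are taken from `FirstOrder.Language`; a relation
symbol is interpreted by a real-valued function. -/

/-- `L`-structures. -/
structure LStructure (L : FirstOrder.Language.{u, v}) where
  /-- the domain -/
  carrier : Type w
  [metric : MetricSpace carrier]
  [complete : CompleteSpace carrier]
  /-- interpretation of the relation symbols -/
  rel : ∀ {n : ℕ}, L.Relations n → (Fin n → carrier) → ℝ
  continuous_rel : ∀ {n : ℕ} (R : L.Relations n), Continuous (rel R)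
  /-- interpretation of the function symbols -/
  fn : ∀ {n : ℕ}, L.Functions n → (Fin n → carrier) → carrier
  continuous_fn : ∀ {n : ℕ} (f : L.Functions n), Continuous (fn f)

namespace LStructure

variable {L : FirstOrder.Language.{u, v}}

instance : CoeSort (LStructure.{u, v, w} L) (Type w) := ⟨LStructure.carrier⟩

instance (M : LStructure.{u, v, w} L) : MetricSpace M := M.metric

instance (M : LStructure.{u, v, w} L) : CompleteSpace M := M.complete

/-- The domain of the `L`-substructure generated by `E`. Since `L`-structures are complete, this
is the smallest closed set that contains `E` and is closed under the function symbols. -/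
def generated (M : LStructure.{u, v, w} L) (E : Set M) : Set M :=
  ⋂₀ {S | E ⊆ S ∧ IsClosed S ∧
    ∀ (n : ℕ) (f : L.Functions n) (a : Fin n → M), (∀ i, a i ∈ S) → M.fn f a ∈ S}

theorem generated_mono (M : LStructure.{u, v, w} L) {E F : Set M} (h : E ⊆ F) :
    M.generated E ⊆ M.generated F :=
  sInter_subset_sInter fun _ hS => ⟨h.trans hS.1, hS.2⟩

/-- The set `E` is a generator of `M`. -/
def IsGenerator (M : LStructure.{u, v, w} L) (E : Set M) : Prop :=
  M.generated E = univ

/-- Finitely generated `L`-structures. -/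
def FinitelyGenerated (M : LStructure.{u, v, w} L) : Prop :=
  ∃ E : Set M, E.Finite ∧ M.IsGenerator E

/-- `L`-embeddings. -/
structure Embedding (M N : LStructure.{u, v, w} L) where
  /-- the underlying map -/
  toFun : M → N
  isometry : Isometry toFun
  map_rel : ∀ {n : ℕ} (R : L.Relations n) (a : Fin n → M),
    M.rel R a = N.rel R fun i => toFun (a i)
  map_fn : ∀ {n : ℕ} (f : L.Functions n) (a : Fin n → M),
    toFun (M.fn f a) = N.fn f fun i => toFun (a i)

namespace Embedding

instance (M N : LStructure.{u, v, w} L) : CoeFun (Embedding M N) fun _ => M → N := ⟨toFun⟩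

/-- The identity embedding. -/
def id (M : LStructure.{u, v, w} L) : Embedding M M :=
  ⟨fun a => a, isometry_id, fun _ _ => rfl, fun _ _ => rfl⟩

/-- The composition of embeddings. -/
def comp {M N P : LStructure.{u, v, w} L} (g : Embedding N P) (f : Embedding M N) :
    Embedding M P :=
  ⟨fun a => g (f a), g.isometry.comp f.isometry,
    fun R a => (f.map_rel R a).trans (g.map_rel R _),
    fun h a => (congrArg g.toFun (f.map_fn h a)).trans (g.map_fn h _)⟩

end Embedding

end LStructure

open LStructure in
/-- A category of finitely generated `L`-structures and `L`-embeddings: a family of finitely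
generated `L`-structures with, for any two of them, a set of `L`-embeddings, containing the
identities and closed under composition. -/
structure StructureCategory (L : FirstOrder.Language.{u, v}) where
  /-- the objects -/
  Obj : Type x
  /-- the `L`-structure that an object is -/
  str : Obj → LStructure.{u, v, w} L
  finitelyGenerated : ∀ A, (str A).FinitelyGenerated
  /-- the morphisms -/
  Hom : ∀ A B, Set (Embedding (str A) (str B))
  id_mem : ∀ A, Embedding.id (str A) ∈ Hom A A
  comp_mem : ∀ {A B C : Obj} {g : Embedding (str B) (str C)} {f : Embedding (str A) (str B)},
    g ∈ Hom B C → f ∈ Hom A B → g.comp f ∈ Hom A C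

namespace StructureCategory

open LStructure

variable {L : FirstOrder.Language.{u, v}} (K : StructureCategory.{u, v, w, x} L)

/-- Finite partial `K`-isomorphisms `ι` from `A` to `B`. That the substructure generated by
`dom ι` is an object of `K` whose inclusion in `A` is a `K`-embedding means that it is the image
of a `K`-embedding `i : D → A` of an object `D`; similarly for `ran ι` and `j : D' → B`. The
map `ι` has to extend to a `K`-isomorphism between these objects. -/
structure FinitePartialIso (A B : K.Obj) where
  /-- the domain of the partial isometry -/
  dom : Set (K.str A)
  finite_dom : dom.Finite
  /-- the partial isometry -/
  toFun : dom → K.str B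
  isometry : Isometry toFun
  extends_to_iso : ∃ (D D' : K.Obj) (i : Embedding (K.str D) (K.str A))
    (j : Embedding (K.str D') (K.str B)) (e : Embedding (K.str D) (K.str D'))
    (e' : Embedding (K.str D') (K.str D)),
    i ∈ K.Hom D A ∧ range i = (K.str A).generated dom ∧
    j ∈ K.Hom D' B ∧ range j = (K.str B).generated (range toFun) ∧
    e ∈ K.Hom D D' ∧ e' ∈ K.Hom D' D ∧ (∀ d, e' (e d) = d) ∧ (∀ d, e (e' d) = d) ∧
    ∀ (a : dom) (d : K.str D), i d = a → toFun a = j (e d)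

/-- The set `Apx_{2,K}(A, B)`: trivial extensions of the `φ_{ι,η}`, for finite partial
`K`-isomorphisms `ι` and `η` of `A` and `B` into an object `C` of `K`. -/
def apxTwo (A B : K.Obj) : Set (Apx (K.str A) (K.str B)) :=
  {φ | ∃ (C : K.Obj) (ι : K.FinitePartialIso A C) (η : K.FinitePartialIso B C),
    φ = Apx.trivExt (Subtype.val : ι.dom → K.str A) (Subtype.val : η.dom → K.str B)
      isometry_subtype_coe isometry_subtype_coe
      (Apx.ofJoint ι.toFun η.toFun ι.isometry η.isometry)}

/-- Inductive systems (sequences) of `K`-embeddings. -/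
structure InductiveSystem where
  /-- the objects of the sequence -/
  obj : ℕ → K.Obj
  /-- the embeddings of the sequence -/
  map : ∀ n, Embedding (K.str (obj n)) (K.str (obj (n + 1)))
  map_mem : ∀ n, map n ∈ K.Hom (obj n) (obj (n + 1))

/-- `K`-structures: an `L`-structure together with an inductive system of `K`-embeddings, of
which it is the inductive limit, i.e. it is the closure of the increasing union of compatible
copies of the objects of the system. -/
structure KStructure where
  /-- the `L`-structure -/
  str : LStructure.{u, v, w} L
  /-- the inductive system -/
  system : K.InductiveSystem
  /-- the canonical embeddings in the inductive limit -/
  incl : ∀ n, Embedding (K.str (system.obj n)) str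
  incl_map : ∀ n a, incl (n + 1) (system.map n a) = incl n a
  dense_iUnion : Dense (⋃ n, range (incl n))

/-- Every inductive sequence of `K`-embeddings has an inductive limit that is an
`L`-structure. -/
def HasInductiveLimits : Prop :=
  ∀ S : K.InductiveSystem, ∃ M : K.KStructure, M.system = S

variable {K} in
/-- An object of `K`, as a `K`-structure: the limit of the constant system. -/
@[reducible] def ofObj (A : K.Obj) : K.KStructure where
  str := K.str A
  system := ⟨fun _ => A, fun _ => Embedding.id _, fun _ => K.id_mem A⟩
  incl _ := Embedding.id _
  incl_map _ _ := rfl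
  dense_iUnion := dense_iff_closure_eq.2 <| by
    rw [show (⋃ _ : ℕ, range (Embedding.id (K.str A))) = univ from
      eq_univ_of_forall fun a => mem_iUnion.2 ⟨0, a, rfl⟩, closure_univ]

variable {K}

/-- The set `Apx_K(M, N)` of approximate `K`-isomorphisms between `K`-structures. -/
def apx (M N : K.KStructure) : Set (Apx M.str N.str) :=
  closure (⋃ (n : ℕ) (m : ℕ), {ψ | ∃ φ ∈ K.apxTwo (M.system.obj n) (N.system.obj m),
    Apx.trivExt (M.incl n) (N.incl m) (M.incl n).isometry (N.incl m).isometry φ ≤ ψ})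

/-- The set `Stx_K(M, N)` of strict approximate `K`-isomorphisms. -/
def stx (M N : K.KStructure) : Set (Apx M.str N.str) :=
  {φ | φ ∈ apx M N ∧ ∃ ψ ∈ apx M N, φ.StrictlyDominates ψ}

/-- `K`-admissible embeddings. -/
def IsAdmissible {M N : K.KStructure} (ι : Embedding M.str N.str) : Prop :=
  Apx.graph ι ι.isometry ∈ apx M N

variable (K)

/-- The joint embedding property. -/
def JEP : Prop :=
  ∀ A B : K.Obj, ∃ C : K.Obj, (K.Hom A C).Nonempty ∧ (K.Hom B C).Nonempty

/-- The near amalgamation property. -/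
def NAP : Prop :=
  ∀ (A B₁ B₂ : K.Obj), ∀ ι₁ ∈ K.Hom A B₁, ∀ ι₂ ∈ K.Hom A B₂,
    ∀ F : Set (K.str A), F.Finite → ∀ ε : ℝ, 0 < ε →
      ∃ C : K.Obj, ∃ η₁ ∈ K.Hom B₁ C, ∃ η₂ ∈ K.Hom B₂ C,
        ∀ a ∈ F, dist (η₁ (ι₁ a)) (η₂ (ι₂ a)) < ε

/-- The class `K_n` of objects of `K` with an ordered generator of length `n`. -/
structure Pointed (n : ℕ) where
  /-- the object -/
  obj : K.Obj
  /-- the ordered generator -/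
  tuple : Fin n → K.str obj
  isGenerator : (K.str obj).IsGenerator (range tuple)

variable {K}

/-- The pseudo-metric `d^K` on `K_n`. -/
noncomputable def dK {n : ℕ} (p q : K.Pointed n) : ℝ≥0∞ :=
  ⨅ φ ∈ apx (ofObj p.obj) (ofObj q.obj), ⨆ i, φ (p.tuple i) (q.tuple i)

/-- Cauchy sequences in `K_n` for `d^K`. -/
def IsCauchy {n : ℕ} (p : ℕ → K.Pointed n) : Prop :=
  ∀ ε : ℝ≥0∞, 0 < ε → ∃ N, ∀ i ≥ N, ∀ j ≥ N, dK (p i) (p j) < ε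

/-- The tuple `(a, b, f(a))`, for a tuple `(a, b)` with `a` of length `n` and `b` of
length `m`. -/
def Pointed.snocFn {n m : ℕ} (f : L.Functions n) (p : K.Pointed (n + m)) :
    K.Pointed (n + m + 1) where
  obj := p.obj
  tuple := Fin.snoc (α := fun _ => (K.str p.obj).carrier) p.tuple
    ((K.str p.obj).fn f fun i => p.tuple (Fin.castAdd m i))
  isGenerator := eq_univ_of_univ_subset <| by
    have h := p.isGenerator
    unfold IsGenerator at h
    rw [← h]
    refine generated_mono _ ?_
    rintro _ ⟨i, rfl⟩
    exact ⟨i.castSucc, Fin.snoc_castSucc (α := fun _ => (K.str p.obj).carrier) _ _ _⟩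

variable (K)

/-- The weak Polish property. -/
def WPP : Prop :=
  ∀ n : ℕ, ∃ S : Set (K.Pointed n), S.Countable ∧
    ∀ p : K.Pointed n, ∀ ε : ℝ≥0∞, 0 < ε → ∃ q ∈ S, dK p q < ε

/-- The Cauchy continuity property. -/
def CCP : Prop :=
  (∀ (n m : ℕ) (P : L.Relations n) (p : ℕ → K.Pointed (n + m)), IsCauchy p →
    CauchySeq fun k => (K.str (p k).obj).rel P fun i => (p k).tuple (Fin.castAdd m i)) ∧
  ∀ (n m : ℕ) (f : L.Functions n) (p : ℕ → K.Pointed (n + m)), IsCauchy p →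
    IsCauchy fun k => (p k).snocFn f

/-- Fraïssé categories. -/
structure IsFraisse : Prop where
  separable : ∀ A : K.Obj, TopologicalSpace.SeparableSpace (K.str A)
  jep : K.JEP
  nap : K.NAP
  wpp : K.WPP
  ccp : K.CCP

variable {K}

/-- Fraïssé limits of `K`. -/
def IsFraisseLimit (M : K.KStructure) : Prop :=
  ∀ N : K.KStructure, ∀ φ ∈ stx N M, ∃ ι : Embedding N.str M.str,
    IsAdmissible ι ∧ φ.StrictlyDominates (Apx.graph ι ι.isometry)

end StructureCategory

/-! The limit is an inductive limit `M` that is generic. Suppose that a generating tuple `p` of an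
object and a finite tuple `c` of a stage of `M` lie in a common object. Then some tuple `p'`, close
to `p` for `d^K`, is `K`-embedded in a later stage, and its distances to `c` exceed the prescribed
ones by as little as desired (`IsGeneric`). By WPP and separability of the objects, countably many
`p'`, points and rational bounds suffice. By NAP each such task can still be accomplished after any
delay, so a book-keeping sequence accomplishes them all (`exists_isGeneric`).

By NAP, membership in `Apx_K` means being bounded below, on finite sets and up to `ε`, by joint
embeddings of stages (`mem_apx_of_joint`, `exists_jointApx_le`). With such a joint embedding,
genericity shrinks a strict approximate isomorphism from `N` to `M` until it nearly matches any
given finite subset of `N` (`IsGeneric.exists_stx_le`). Iterating along a dense union of finite sets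
gives a decreasing sequence, which converges to an isometry since `M` is complete
(`Apx.exists_isometry_of_antitone`). Only an embedding of `N` is wanted, so no back-and-forth is
needed.

The isometry preserves the symbols by CCP: a generating tuple of a stage of `N` is the `d^K`-limit
of tuples that are embedded in `M` and converge there to its image (`IsGeneric.map_rel_incl`,
`IsGeneric.map_fn_incl`). -/

namespace Apx

variable {X Y Z X' Y' : Type*} [MetricSpace X] [MetricSpace Y] [MetricSpace Z]
  [MetricSpace X'] [MetricSpace Y']

/-! ### Trivial extensions, thickenings and strict domination -/

theorem trivExt_apply (ι : X → X') (η : Y → Y') (hι : Isometry ι) (hη : Isometry η)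
    (φ : Apx X Y) (p : X') (q : Y') :
    trivExt ι η hι hη φ p q = ⨅ b, (⨅ a, edist (ι a) p + φ a b) + edist (η b) q := rfl

theorem trivExt_le (ι : X → X') (η : Y → Y') (hι : Isometry ι) (hη : Isometry η)
    (φ : Apx X Y) (p : X') (q : Y') (a : X) (b : Y) :
    trivExt ι η hι hη φ p q ≤ edist p (ι a) + φ a b + edist (η b) q := by
  rw [trivExt_apply, edist_comm p]
  exact (iInf_le _ b).trans (by gcongr; exact iInf_le _ a)

theorem le_trivExt (ι : X → X') (η : Y → Y') (hι : Isometry ι) (hη : Isometry η)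
    (φ : Apx X Y) (p : X') (q : Y') (c : ℝ≥0∞)
    (h : ∀ a b, c ≤ edist p (ι a) + φ a b + edist (η b) q) :
    c ≤ trivExt ι η hι hη φ p q := by
  rw [trivExt_apply]
  refine le_iInf fun b => ?_
  rw [ENNReal.iInf_add]
  refine le_iInf fun a => ?_
  rw [edist_comm _ p]
  exact h a b

theorem exists_of_trivExt_lt (ι : X → X') (η : Y → Y') (hι : Isometry ι) (hη : Isometry η)
    (φ : Apx X Y) (p : X') (q : Y') (c : ℝ≥0∞) (h : trivExt ι η hι hη φ p q < c) :
    ∃ a b, edist p (ι a) + φ a b + edist (η b) q < c := by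
  by_contra! H
  exact absurd (le_trivExt ι η hι hη φ p q c H) (not_le.2 h)

theorem apply_le (φ : Apx X Y) (p p' : X) (q q' : Y) :
    φ p q ≤ edist p p' + φ p' q' + edist q' q := by
  calc φ p q ≤ edist p p' + φ p' q := (φ.2.1 q).1 p p'
    _ ≤ edist p p' + (edist q q' + φ p' q') := by
      gcongr
      exact (φ.2.2 p').1 q q'
    _ = _ := by rw [edist_comm q]; ring

/-- The value of a trivial extension at a pair of points of the original spaces. -/
theorem le_trivExt_map (ι : X → X') (η : Y → Y') (hι : Isometry ι) (hη : Isometry η)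
    (φ : Apx X Y) (a : X) (b : Y) : φ a b ≤ trivExt ι η hι hη φ (ι a) (η b) :=
  le_trivExt _ _ _ _ _ _ _ _ fun a' b' => by
    rw [hι.edist_eq, hη.edist_eq]
    exact apply_le φ a a' b b'

/-- Restrict `φ` to finite sets, add a constant, and extend trivially. -/
noncomputable def thicken (φ : Apx X Y) (F : Set X) (G : Set Y) (ε : ℝ≥0∞) : Apx X Y :=
  trivExt (Subtype.val : F → X) (Subtype.val : G → Y) isometry_subtype_coe isometry_subtype_coe
    ⟨fun p q => φ p q + ε,
      fun q => ⟨fun p p' => by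
          rw [← add_assoc]
          exact add_le_add ((φ.2.1 q).1 p p') le_rfl,
        fun p p' => ((φ.2.1 q).2 p p').trans (by gcongr <;> exact le_self_add)⟩,
      fun p => ⟨fun q q' => by
          rw [← add_assoc]
          exact add_le_add ((φ.2.2 p).1 q q') le_rfl,
        fun q q' => ((φ.2.2 p).2 q q').trans (by gcongr <;> exact le_self_add)⟩⟩

theorem thicken_le (φ : Apx X Y) {F : Set X} {G : Set Y} (ε : ℝ≥0∞) {p : X} {q : Y}
    (hp : p ∈ F) (hq : q ∈ G) : thicken φ F G ε p q ≤ φ p q + ε := by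
  refine (trivExt_le _ _ _ _ _ p q ⟨p, hp⟩ ⟨q, hq⟩).trans ?_
  simp

/-- A trivial extension is the largest approximate isometry obeying its bounds on `F × G`. So
finitely many inequalities imply one everywhere. -/
theorem le_thicken {φ χ : Apx X Y} {F : Set X} {G : Set Y} {ε : ℝ≥0∞}
    (h : ∀ p ∈ F, ∀ q ∈ G, χ p q ≤ φ p q + ε) : χ ≤ thicken φ F G ε := by
  intro p q
  refine le_trivExt _ _ _ _ _ _ _ _ fun a b => (apply_le χ p a q b).trans ?_
  gcongr
  exact h a a.2 b b.2

theorem thicken_eq (φ : Apx X Y) {F : Set X} {G : Set Y} (ε : ℝ≥0∞) {p : X} {q : Y}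
    (hp : p ∈ F) (hq : q ∈ G) : thicken φ F G ε p q = φ p q + ε :=
  (thicken_le φ ε hp hq).antisymm <| le_trivExt_map (Subtype.val : F → X) (Subtype.val : G → Y)
    _ _ _ ⟨p, hp⟩ ⟨q, hq⟩

theorem setOf_le_add_mem_nhds (φ : Apx X Y) {F : Set X} {G : Set Y} (hF : F.Finite)
    (hG : G.Finite) {ε : ℝ≥0∞} (hε : 0 < ε) :
    {χ : Apx X Y | ∀ p ∈ F, ∀ q ∈ G, χ p q ≤ φ p q + ε} ∈ 𝓝 φ := by
  have : {χ : Apx X Y | ∀ p ∈ F, ∀ q ∈ G, χ p q ≤ φ p q + ε} =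
      ⋂ p ∈ F, ⋂ q ∈ G, {χ : Apx X Y | χ p q ≤ φ p q + ε} := by
    ext; simp
  rw [this]
  refine (Filter.biInter_mem hF).2 fun p _ => (Filter.biInter_mem hG).2 fun q _ => ?_
  have hc : Continuous fun χ : Apx X Y => χ p q :=
    (continuous_apply q).comp ((continuous_apply p).comp continuous_subtype_val)
  refine hc.continuousAt.preimage_mem_nhds (t := Iic (φ p q + ε)) ?_
  by_cases h : φ p q = ∞
  · simp [h]
  · exact Iic_mem_nhds (ENNReal.lt_add_right h hε.ne')

/-- Thickenings converge pointwise to `φ` as `ε` decreases to `0` and `F`, `G` grow: at `(p, q)` the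
value is exactly `φ p q + ε` once `p ∈ F` and `q ∈ G`. -/
theorem exists_thicken_mem {φ : Apx X Y} {U : Set (Apx X Y)} (hU : U ∈ 𝓝 φ) :
    ∃ (F : Set X) (G : Set Y) (ε : ℝ), F.Finite ∧ G.Finite ∧ 0 < ε ∧
      thicken φ F G (ENNReal.ofReal ε) ∈ U := by
  classical
  have ht : Filter.Tendsto (fun t : ℝ × Finset X × Finset Y =>
      thicken φ (t.2.1 : Set X) (t.2.2 : Set Y) (ENNReal.ofReal t.1))
      (𝓝[>] (0 : ℝ) ×ˢ (Filter.atTop ×ˢ Filter.atTop)) (𝓝 φ) := by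
    refine tendsto_subtype_rng.2 (tendsto_pi_nhds.2 fun p => tendsto_pi_nhds.2 fun q => ?_)
    have h1 : Filter.Tendsto (fun t : ℝ × Finset X × Finset Y => φ p q + ENNReal.ofReal t.1)
        (𝓝[>] (0 : ℝ) ×ˢ (Filter.atTop ×ˢ Filter.atTop)) (𝓝 (φ p q)) := by
      have : Filter.Tendsto (fun t : ℝ => φ p q + ENNReal.ofReal t) (𝓝[>] (0 : ℝ))
          (𝓝 (φ p q + ENNReal.ofReal 0)) :=
        (tendsto_const_nhds.add (ENNReal.tendsto_ofReal Filter.tendsto_id)).mono_left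
          nhdsWithin_le_nhds
      rw [ENNReal.ofReal_zero, add_zero] at this
      exact this.comp Filter.tendsto_fst
    refine h1.congr' ?_
    have h2 : ∀ᶠ t : ℝ × Finset X × Finset Y in
        𝓝[>] (0 : ℝ) ×ˢ (Filter.atTop ×ˢ Filter.atTop), p ∈ t.2.1 ∧ q ∈ t.2.2 := by
      refine Filter.Eventually.and ?_ ?_
      · exact (Filter.tendsto_fst.comp Filter.tendsto_snd).eventually
          ((Filter.eventually_ge_atTop {p}).mono fun s hs => Finset.singleton_subset_iff.1 hs)
      · exact (Filter.tendsto_snd.comp Filter.tendsto_snd).eventually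
          ((Filter.eventually_ge_atTop {q}).mono fun s hs => Finset.singleton_subset_iff.1 hs)
    filter_upwards [h2] with t h
    exact (thicken_eq φ _ (Finset.mem_coe.2 h.1) (Finset.mem_coe.2 h.2)).symm
  have h3 : ∀ᶠ t : ℝ × Finset X × Finset Y in
      𝓝[>] (0 : ℝ) ×ˢ (Filter.atTop ×ˢ Filter.atTop), 0 < t.1 :=
    Filter.tendsto_fst.eventually (self_mem_nhdsWithin : ∀ᶠ t : ℝ in 𝓝[>] 0, t ∈ Ioi 0)
  obtain ⟨t, h4, h5⟩ := ((ht.eventually hU).and h3).exists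
  exact ⟨t.2.1, t.2.2, t.1, t.2.1.finite_toSet, t.2.2.finite_toSet, h5, h4⟩

theorem exists_of_strictlyDominates {φ ψ : Apx X Y} (h : φ.StrictlyDominates ψ) :
    ∃ (F : Set X) (G : Set Y) (ε : ℝ), F.Finite ∧ G.Finite ∧ 0 < ε ∧
      ∀ χ : Apx X Y, (∀ p ∈ F, ∀ q ∈ G, χ p q ≤ ψ p q + ENNReal.ofReal ε) → χ ≤ φ := by
  obtain ⟨F, G, ε, hF, hG, hε, H⟩ := exists_thicken_mem (mem_interior_iff_mem_nhds.1 h)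
  exact ⟨F, G, ε, hF, hG, hε, fun χ hχ => (le_thicken hχ).trans H⟩

theorem strictlyDominates_of {φ ψ : Apx X Y} {F : Set X} {G : Set Y} {ε : ℝ} (hF : F.Finite)
    (hG : G.Finite) (hε : 0 < ε)
    (h : ∀ χ : Apx X Y, (∀ p ∈ F, ∀ q ∈ G, χ p q ≤ ψ p q + ENNReal.ofReal ε) → χ ≤ φ) :
    φ.StrictlyDominates ψ :=
  mem_interior_iff_mem_nhds.2 <| Filter.mem_of_superset
    (setOf_le_add_mem_nhds ψ hF hG (ENNReal.ofReal_pos.2 hε)) h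

theorem thicken_strictlyDominates (φ : Apx X Y) {F : Set X} {G : Set Y} {ε : ℝ} (hF : F.Finite)
    (hG : G.Finite) (hε : 0 < ε) : (thicken φ F G (ENNReal.ofReal ε)).StrictlyDominates φ :=
  strictlyDominates_of hF hG hε fun _ h => le_thicken h

/-- A neighbourhood of `φ` contains a thickening of `φ`, and this lies above `χ`, hence in `U`.
One-sided estimates therefore suffice. -/
theorem mem_closure_of_isUpperSet {U : Set (Apx X Y)} (hU : IsUpperSet U) {φ : Apx X Y}
    (h : ∀ (F : Set X) (G : Set Y) (ε : ℝ), F.Finite → G.Finite → 0 < ε →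
      ∃ χ ∈ U, ∀ p ∈ F, ∀ q ∈ G, χ p q ≤ φ p q + ENNReal.ofReal ε) : φ ∈ closure U := by
  refine mem_closure_iff_nhds.2 fun V hV => ?_
  obtain ⟨F, G, ε, hF, hG, hε, H⟩ := exists_thicken_mem hV
  obtain ⟨χ, hχ, hle⟩ := h F G ε hF hG hε
  exact ⟨_, H, hU (le_thicken hle) hχ⟩

end Apx

theorem Set.Finite.exists_finite_witnesses {α β : Type*} {T : Set α} (hT : T.Finite)
    {P : α → β → Prop} (h : ∀ p ∈ T, ∃ c, P p c) : ∃ S : Set β, S.Finite ∧ ∀ p ∈ T, ∃ c ∈ S, P p c := by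
  choose c hc using h
  have := hT.to_subtype
  exact ⟨range fun p : T => c p p.2, finite_range _, fun p hp => ⟨_, ⟨⟨p, hp⟩, rfl⟩, hc p hp⟩⟩

theorem edist_le_edist_add_ofReal {X Y : Type*} [PseudoMetricSpace X] [PseudoMetricSpace Y]
    {a b : X} {c d : Y} {δ : ℝ} (hδ : 0 ≤ δ) (h : dist a b ≤ dist c d + δ) :
    edist a b ≤ edist c d + ENNReal.ofReal δ := by
  rw [edist_dist, edist_dist, ← ENNReal.ofReal_add dist_nonneg hδ]
  exact ENNReal.ofReal_le_ofReal h

theorem edist_le_ofReal_of_dist_le {X : Type*} [PseudoMetricSpace X] {a b : X} {δ : ℝ}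
    (h : dist a b ≤ δ) : edist a b ≤ ENNReal.ofReal δ := by
  rw [edist_dist]
  exact ENNReal.ofReal_le_ofReal h

namespace LStructure

variable {L : FirstOrder.Language.{u, v}}

theorem subset_generated (M : LStructure.{u, v, w} L) (E : Set M) : E ⊆ M.generated E :=
  subset_sInter fun _ hS => hS.1

theorem IsGenerator.mono {M : LStructure.{u, v, w} L} {E F : Set M} (hE : M.IsGenerator E)
    (h : E ⊆ F) : M.IsGenerator F :=
  eq_univ_of_univ_subset (hE.symm.subset.trans (M.generated_mono h))

theorem IsGenerator.generated_image {M N : LStructure.{u, v, w} L} {E : Set M}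
    (hE : M.IsGenerator E) (f : Embedding M N) : N.generated (f '' E) = range f := by
  apply subset_antisymm
  · refine sInter_subset_of_mem ⟨image_subset_range _ _, f.isometry.isClosedEmbedding.isClosed_range,
      fun n g a ha => ?_⟩
    choose b hb using ha
    exact ⟨M.fn g b, by rw [f.map_fn]; simp only [hb]⟩
  · rintro _ ⟨a, rfl⟩
    refine mem_sInter.2 fun S ⟨h1, h2, h3⟩ => ?_
    have : M.generated E ⊆ f ⁻¹' S := sInter_subset_of_mem
      ⟨image_subset_iff.1 h1, h2.preimage f.isometry.continuous, fun n g b hb => by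
        rw [mem_preimage, f.map_fn]
        exact h3 n g _ hb⟩
    exact this (hE.symm.subset (mem_univ a))

end LStructure

/-! ### Approximate `K`-isomorphisms as joint embeddings -/

namespace StructureCategory

open LStructure

variable {L : FirstOrder.Language.{u, v}} {K : StructureCategory.{u, v, w, x} L}

/-- The restriction of a `K`-embedding to a finite generator. -/
def FinitePartialIso.ofHom {A C : K.Obj} (f : Embedding (K.str A) (K.str C)) (hf : f ∈ K.Hom A C)
    (S : Set (K.str A)) (hS : S.Finite) (hg : (K.str A).IsGenerator S) :
    K.FinitePartialIso A C where
  dom := S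
  finite_dom := hS
  toFun a := f a
  isometry := f.isometry.comp isometry_subtype_coe
  extends_to_iso := ⟨A, A, Embedding.id _, f, Embedding.id _, Embedding.id _, K.id_mem A,
    by rw [hg]; exact eq_univ_of_forall fun a => ⟨a, rfl⟩, hf,
    by rw [← hg.generated_image f, image_eq_range], K.id_mem A, K.id_mem A,
    fun _ => rfl, fun _ => rfl, fun _ _ h => congrArg f.toFun h.symm⟩

/-- NAP over the object `D` generated by `dom ι`, which embeds in `A` directly and in `C` through
`D'`. -/
theorem FinitePartialIso.exists_amalgam (hK : K.NAP) {A C : K.Obj} (ι : K.FinitePartialIso A C)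
    {ε : ℝ} (hε : 0 < ε) : ∃ E, ∃ f ∈ K.Hom A E, ∃ h ∈ K.Hom C E,
      ∀ a : ι.dom, dist (f a) (h (ι.toFun a)) < ε := by
  obtain ⟨D, D', i, j, e, e', hi, hri, hj, -, he, -, -, -, H⟩ := ι.extends_to_iso
  obtain ⟨E, f, hf, h, hh, hd⟩ := hK D A C i hi (j.comp e) (K.comp_mem hj he) (i ⁻¹' ι.dom)
    (ι.finite_dom.preimage i.isometry.injective.injOn) ε hε
  refine ⟨E, f, hf, h, hh, fun a => ?_⟩
  obtain ⟨d, hda⟩ : (a : K.str A) ∈ range i := hri ▸ subset_generated _ _ a.2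
  have := hd d (by rw [mem_preimage, hda]; exact a.2)
  rw [hda] at this
  rwa [H a d hda]

/-- Partial isomorphisms are replaced by embeddings of the whole objects: one amalgam for each of
`ι` and `η`, and one over `C` to join them, each costing `ε / 3`. -/
theorem exists_ofJoint_le (hK : K.NAP) {A B : K.Obj} {φ : Apx (K.str A) (K.str B)}
    (hφ : φ ∈ K.apxTwo A B) {ε : ℝ} (hε : 0 < ε) :
    ∃ E, ∃ f ∈ K.Hom A E, ∃ g ∈ K.Hom B E, ∀ a b,
      edist (f a) (g b) ≤ φ a b + ENNReal.ofReal ε := by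
  obtain ⟨C, ι, η, rfl⟩ := hφ
  obtain ⟨C₁, f₁, hf₁, h₁, hh₁, H₁⟩ := ι.exists_amalgam hK (show 0 < ε / 3 by positivity)
  obtain ⟨C₂, f₂, hf₂, h₂, hh₂, H₂⟩ := η.exists_amalgam hK (show 0 < ε / 3 by positivity)
  have := ι.finite_dom.to_subtype
  obtain ⟨E, k₁, hk₁, k₂, hk₂, H⟩ := hK C C₁ C₂ h₁ hh₁ h₂ hh₂ (range ι.toFun) (finite_range _)
    (ε / 3) (by positivity)
  refine ⟨E, k₁.comp f₁, K.comp_mem hk₁ hf₁, k₂.comp f₂, K.comp_mem hk₂ hf₂, fun a b => ?_⟩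
  rw [← tsub_le_iff_right]
  refine Apx.le_trivExt _ _ _ _ _ _ _ _ fun a' b' => ?_
  rw [tsub_le_iff_right]
  have key : edist (k₁ (f₁ a')) (k₂ (f₂ b')) ≤
      edist (ι.toFun a') (η.toFun b') + ENNReal.ofReal ε := by
    refine edist_le_edist_add_ofReal hε.le ?_
    have e1 := H₁ a'
    rw [← k₁.isometry.dist_eq] at e1
    have e2 := H₂ b'
    rw [← k₂.isometry.dist_eq, dist_comm] at e2
    have e3 := H _ ⟨a', rfl⟩
    have e4 : dist (k₂ (h₂ (ι.toFun a'))) (k₂ (h₂ (η.toFun b'))) =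
      dist (ι.toFun a') (η.toFun b') := by rw [k₂.isometry.dist_eq, h₂.isometry.dist_eq]
    have t1 := dist_triangle (k₁ (f₁ a')) (k₁ (h₁ (ι.toFun a'))) (k₂ (f₂ b'))
    have t2 := dist_triangle (k₁ (h₁ (ι.toFun a'))) (k₂ (h₂ (ι.toFun a'))) (k₂ (f₂ b'))
    have t3 := dist_triangle (k₂ (h₂ (ι.toFun a'))) (k₂ (h₂ (η.toFun b'))) (k₂ (f₂ b'))
    linarith
  calc edist (k₁ (f₁ a)) (k₂ (f₂ b))
      ≤ edist (k₁ (f₁ a)) (k₁ (f₁ a')) + edist (k₁ (f₁ a')) (k₂ (f₂ b')) +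
        edist (k₂ (f₂ b')) (k₂ (f₂ b)) := edist_triangle4 _ _ _ _
    _ ≤ edist (a : K.str A) a' + (edist (ι.toFun a') (η.toFun b') + ENNReal.ofReal ε) +
        edist (b' : K.str B) b := by
      rw [k₁.isometry.edist_eq, f₁.isometry.edist_eq, k₂.isometry.edist_eq, f₂.isometry.edist_eq]
      gcongr
    _ = edist (a : K.str A) a' + edist (ι.toFun a') (η.toFun b') + edist (b' : K.str B) b +
        ENNReal.ofReal ε := by ring

/-- The approximate isometry between `K`-structures that is given by a joint embedding of objects
of their inductive systems. -/
noncomputable abbrev jointApx (N M : K.KStructure) {n m : ℕ} {D : K.Obj}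
    (f : Embedding (K.str (N.system.obj n)) (K.str D))
    (g : Embedding (K.str (M.system.obj m)) (K.str D)) : Apx N.str M.str :=
  Apx.trivExt (N.incl n) (M.incl m) (N.incl n).isometry (M.incl m).isometry
    (Apx.ofJoint f g f.isometry g.isometry)

theorem exists_finite_isGenerator (A : K.Obj) (F : Set (K.str A)) (hF : F.Finite) :
    ∃ S : Set (K.str A), S.Finite ∧ F ⊆ S ∧ (K.str A).IsGenerator S := by
  obtain ⟨E, hE, hg⟩ := K.finitelyGenerated A
  exact ⟨F ∪ E, hF.union hE, subset_union_left, hg.mono subset_union_right⟩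

/-- NAP controls only finitely many points, so near-minimizers of the infimum defining `jointApx`
are collected in finite sets. Where the value is `∞` no strict near-minimizer exists, and none is
needed. -/
theorem exists_finite_realizing (N M : K.KStructure) {n m : ℕ} {D : K.Obj}
    (f : Embedding (K.str (N.system.obj n)) (K.str D))
    (g : Embedding (K.str (M.system.obj m)) (K.str D))
    {F : Set N.str} {G : Set M.str} (hF : F.Finite) (hG : G.Finite) {δ : ℝ} (hδ : 0 < δ) :
    ∃ S : Set (K.str (N.system.obj n)), ∃ T : Set (K.str (M.system.obj m)), S.Finite ∧ T.Finite ∧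
      ∀ p ∈ F, ∀ q ∈ G, jointApx N M f g p q ≠ ∞ → ∃ a ∈ S, ∃ b ∈ T,
        edist p (N.incl n a) + edist (f a) (g b) + edist (M.incl m b) q <
          jointApx N M f g p q + ENNReal.ofReal δ := by
  obtain ⟨S, hS, H⟩ := ((hF.prod hG).inter_of_left
    {p | jointApx N M f g p.1 p.2 ≠ ∞}).exists_finite_witnesses
    (P := fun p (c : K.str (N.system.obj n) × K.str (M.system.obj m)) =>
      edist p.1 (N.incl n c.1) + edist (f c.1) (g c.2) + edist (M.incl m c.2) p.2 <
          jointApx N M f g p.1 p.2 + ENNReal.ofReal δ) (by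
      rintro p ⟨-, hp⟩
      obtain ⟨a, b, h⟩ := Apx.exists_of_trivExt_lt _ _ _ _ _ _ _ _
        (ENNReal.lt_add_right hp (ENNReal.ofReal_pos.2 hδ).ne')
      exact ⟨(a, b), h⟩)
  refine ⟨Prod.fst '' S, Prod.snd '' S, hS.image _, hS.image _, fun p hp q hq hpq => ?_⟩
  obtain ⟨c, hc, h⟩ := H (p, q) ⟨⟨hp, hq⟩, hpq⟩
  exact ⟨c.1, mem_image_of_mem _ hc, c.2, mem_image_of_mem _ hc, h⟩

/-- Restricting `f` and `g` to finite generators that contain the near-minimizers gives finite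
partial `K`-isomorphisms, at the cost of a small error on `F × G`. -/
theorem mem_apx_of_joint {N M : K.KStructure} {ψ : Apx N.str M.str}
    (h : ∀ (F : Set N.str) (G : Set M.str) (ε : ℝ), F.Finite → G.Finite → 0 < ε →
      ∃ n m D, ∃ f ∈ K.Hom (N.system.obj n) D, ∃ g ∈ K.Hom (M.system.obj m) D,
        ∀ p ∈ F, ∀ q ∈ G, jointApx N M f g p q ≤ ψ p q + ENNReal.ofReal ε) :
    ψ ∈ apx N M := by
  refine Apx.mem_closure_of_isUpperSet ?_ fun F G ε hF hG hε => ?_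
  · intro χ χ' hle hχ
    simp only [mem_iUnion] at hχ ⊢
    obtain ⟨n, m, φ, hφ, hφχ⟩ := hχ
    exact ⟨n, m, φ, hφ, hφχ.trans hle⟩
  · obtain ⟨n, m, D, f, hf, g, hg, H⟩ := h F G (ε / 2) hF hG (by positivity)
    obtain ⟨S, T, hS, hT, H'⟩ := exists_finite_realizing N M f g hF hG
      (show 0 < ε / 2 by positivity)
    obtain ⟨S', hS', hSS', hgS⟩ := exists_finite_isGenerator _ S hS
    obtain ⟨T', hT', hTT', hgT⟩ := exists_finite_isGenerator _ T hT
    let ι := FinitePartialIso.ofHom f hf S' hS' hgS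
    let η := FinitePartialIso.ofHom g hg T' hT' hgT
    refine ⟨_, mem_iUnion.2 ⟨n, mem_iUnion.2 ⟨m, _, ⟨D, ι, η, rfl⟩, le_rfl⟩⟩, fun p hp q hq => ?_⟩
    by_cases hψ : ψ p q = ∞
    · simp [hψ]
    have hle := H p hp q hq
    obtain ⟨a, ha, b, hb, hlt⟩ := H' p hp q hq (ne_top_of_le_ne_top (by simp [hψ]) hle)
    refine (Apx.trivExt_le _ _ _ _ _ p q a b).trans ?_
    refine (add_le_add (add_le_add le_rfl
      (Apx.trivExt_le _ _ _ _ _ a b ⟨a, hSS' ha⟩ ⟨b, hTT' hb⟩)) le_rfl).trans ?_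
    rw [edist_self, edist_self, zero_add, add_zero]
    refine hlt.le.trans ((add_le_add hle le_rfl).trans ?_)
    rw [add_assoc, ← ENNReal.ofReal_add (by positivity) (by positivity), add_halves]

theorem exists_jointApx_le (hK : K.NAP) {N M : K.KStructure} {ψ : Apx N.str M.str}
    (hψ : ψ ∈ apx N M) {F : Set N.str} {G : Set M.str} (hF : F.Finite) (hG : G.Finite)
    {ε : ℝ} (hε : 0 < ε) :
    ∃ n m D, ∃ f ∈ K.Hom (N.system.obj n) D, ∃ g ∈ K.Hom (M.system.obj m) D,
        ∀ p ∈ F, ∀ q ∈ G, jointApx N M f g p q ≤ ψ p q + ENNReal.ofReal ε := by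
  obtain ⟨χ, hχ, hχU⟩ := mem_closure_iff_nhds.1 hψ _
    (Apx.setOf_le_add_mem_nhds ψ hF hG (ENNReal.ofReal_pos.2 (half_pos hε)))
  simp only [mem_iUnion] at hχU
  obtain ⟨n, m, φ, hφ, hφχ⟩ := hχU
  obtain ⟨D, f, hf, g, hg, H⟩ := exists_ofJoint_le hK hφ (half_pos hε)
  refine ⟨n, m, D, f, hf, g, hg, fun p hp q hq => ?_⟩
  have h1 : jointApx N M f g p q ≤ Apx.trivExt (N.incl n) (M.incl m) (N.incl n).isometry
      (M.incl m).isometry φ p q + ENNReal.ofReal (ε / 2) := by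
    rw [← tsub_le_iff_right]
    refine Apx.le_trivExt _ _ _ _ _ _ _ _ fun a b => ?_
    rw [tsub_le_iff_right]
    refine (Apx.trivExt_le _ _ _ _ _ p q a b).trans ?_
    calc edist p (N.incl n a) + edist (f a) (g b) + edist (M.incl m b) q
        ≤ edist p (N.incl n a) + (φ a b + ENNReal.ofReal (ε / 2)) + edist (M.incl m b) q := by
          gcongr; exact H a b
      _ = _ := by ring
  calc jointApx N M f g p q ≤ χ p q + ENNReal.ofReal (ε / 2) :=
        h1.trans (add_le_add (hφχ p q) le_rfl)
    _ ≤ ψ p q + ENNReal.ofReal (ε / 2) + ENNReal.ofReal (ε / 2) :=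
        add_le_add (hχ p hp q hq) le_rfl
    _ = ψ p q + ENNReal.ofReal ε := by
        rw [add_assoc, ← ENNReal.ofReal_add (by positivity) (by positivity), add_halves]

theorem apx_mono (hK : K.NAP) {N M : K.KStructure} {ψ χ : Apx N.str M.str}
    (hψ : ψ ∈ apx N M) (h : ψ ≤ χ) : χ ∈ apx N M :=
  mem_apx_of_joint fun F G ε hF hG hε => by
    obtain ⟨n, m, D, f, hf, g, hg, H⟩ := exists_jointApx_le hK hψ hF hG hε
    exact ⟨n, m, D, f, hf, g, hg, fun p hp q hq =>
      (H p hp q hq).trans (add_le_add (h p q) le_rfl)⟩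

theorem jointApx_mem_apx {N M : K.KStructure} {n m : ℕ} {D : K.Obj}
    {f : Embedding (K.str (N.system.obj n)) (K.str D)}
    {g : Embedding (K.str (M.system.obj m)) (K.str D)} (hf : f ∈ K.Hom (N.system.obj n) D)
    (hg : g ∈ K.Hom (M.system.obj m) D) : jointApx N M f g ∈ apx N M :=
  mem_apx_of_joint fun _ _ _ _ _ _ =>
    ⟨n, m, D, f, hf, g, hg, fun _ _ _ _ => le_self_add⟩

theorem thicken_mem_stx (hK : K.NAP) {N M : K.KStructure} {ψ : Apx N.str M.str}
    (hψ : ψ ∈ apx N M) {F : Set N.str} {G : Set M.str} (hF : F.Finite) (hG : G.Finite)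
    {ε : ℝ} (hε : 0 < ε) : Apx.thicken ψ F G (ENNReal.ofReal ε) ∈ stx N M :=
  ⟨apx_mono hK hψ (Apx.le_thicken fun _ _ _ _ => le_self_add), ψ, hψ,
    Apx.thicken_strictlyDominates ψ hF hG hε⟩

/-! ### Passing to later stages -/

theorem KStructure.exists_trans (M : K.KStructure) {m k : ℕ} (h : m ≤ k) :
    ∃ t ∈ K.Hom (M.system.obj m) (M.system.obj k), ∀ a, M.incl k (t a) = M.incl m a := by
  induction k, h using Nat.le_induction with
  | base => exact ⟨Embedding.id _, K.id_mem _, fun _ => rfl⟩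
  | succ k _ ih =>
    obtain ⟨t, ht, H⟩ := ih
    exact ⟨(M.system.map k).comp t, K.comp_mem (M.system.map_mem k) ht,
      fun a => (M.incl_map k (t a)).trans (H a)⟩

theorem KStructure.exists_near (M : K.KStructure) {F : Set M.str} (hF : F.Finite) {δ : ℝ}
    (hδ : 0 < δ) (m₀ : ℕ) : ∃ m ≥ m₀, ∀ k ≥ m, ∀ p ∈ F, ∃ a, dist (M.incl k a) p < δ := by
  induction F, hF using Set.Finite.induction_on with
  | empty => exact ⟨m₀, le_rfl, by simp⟩
  | @insert p F _ _ ih =>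
    obtain ⟨m, hm, H⟩ := ih
    obtain ⟨q, hq, hpq⟩ := Metric.dense_iff.1 M.dense_iUnion p δ hδ
    obtain ⟨l, a, rfl⟩ := mem_iUnion.1 hpq
    refine ⟨max m l, hm.trans (le_max_left _ _), fun k hk => ?_⟩
    rintro _ (rfl | hp)
    · obtain ⟨t, -, ht⟩ := M.exists_trans ((le_max_right m l).trans hk)
      exact ⟨t a, by rw [ht]; exact hq⟩
    · exact H k ((le_max_left _ _).trans hk) _ hp

/-- NAP is applied twice, first to move the left stage from `n` to `n'`, then the right one from `m`
to `m'`. Only the finite sets of near-minimizers have to be kept. -/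
theorem exists_joint_enlarge (hK : K.NAP) (N M : K.KStructure) {n m n' m' : ℕ} (hn : n ≤ n')
    (hm : m ≤ m') {D : K.Obj} {f : Embedding (K.str (N.system.obj n)) (K.str D)}
    {g : Embedding (K.str (M.system.obj m)) (K.str D)} (hf : f ∈ K.Hom (N.system.obj n) D)
    (hg : g ∈ K.Hom (M.system.obj m) D) {F : Set N.str} {G : Set M.str} (hF : F.Finite)
    (hG : G.Finite) {δ : ℝ} (hδ : 0 < δ) :
    ∃ D', ∃ f' ∈ K.Hom (N.system.obj n') D', ∃ g' ∈ K.Hom (M.system.obj m') D',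
      ∀ p ∈ F, ∀ q ∈ G, jointApx N M f' g' p q ≤ jointApx N M f g p q + ENNReal.ofReal δ := by
  obtain ⟨S, T, hS, hT, H⟩ := exists_finite_realizing N M f g hF hG (half_pos hδ)
  obtain ⟨t, ht, ht'⟩ := N.exists_trans hn
  obtain ⟨s, hs, hs'⟩ := M.exists_trans hm
  obtain ⟨D₁, f₁, hf₁, h₁, hh₁, H₁⟩ := hK _ _ _ t ht f hf S hS (δ / 4) (by positivity)
  obtain ⟨D₂, g₂, hg₂, h₂, hh₂, H₂⟩ := hK _ _ _ s hs (h₁.comp g) (K.comp_mem hh₁ hg) T hT (δ / 4)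
    (by positivity)
  refine ⟨D₂, h₂.comp f₁, K.comp_mem hh₂ hf₁, g₂, hg₂, fun p hp q hq => ?_⟩
  by_cases hpq : jointApx N M f g p q = ∞
  · simp [hpq]
  obtain ⟨a, ha, b, hb, hlt⟩ := H p hp q hq hpq
  refine (Apx.trivExt_le _ _ _ _ _ p q (t a) (s b)).trans ?_
  rw [ht', hs']
  have key : edist (h₂ (f₁ (t a))) (g₂ (s b)) ≤ edist (f a) (g b) + ENNReal.ofReal (δ / 2) := by
    refine edist_le_edist_add_ofReal (by positivity) ?_
    have e1 := H₁ a ha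
    rw [← h₂.isometry.dist_eq] at e1
    have e2 : dist (g₂ (s b)) (h₂ (h₁ (g b))) < _ := H₂ b hb
    rw [dist_comm] at e2
    have e4 : dist (h₂ (h₁ (f a))) (h₂ (h₁ (g b))) = dist (f a) (g b) := by
      rw [h₂.isometry.dist_eq, h₁.isometry.dist_eq]
    have t1 := dist_triangle4 (h₂ (f₁ (t a))) (h₂ (h₁ (f a))) (h₂ (h₁ (g b))) (g₂ (s b))
    linarith
  calc edist p (N.incl n a) + edist (h₂ (f₁ (t a))) (g₂ (s b)) + edist (M.incl m b) q
      ≤ edist p (N.incl n a) + (edist (f a) (g b) + ENNReal.ofReal (δ / 2)) +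
        edist (M.incl m b) q := by gcongr
    _ = edist p (N.incl n a) + edist (f a) (g b) + edist (M.incl m b) q +
        ENNReal.ofReal (δ / 2) := by ring
    _ ≤ jointApx N M f g p q + ENNReal.ofReal (δ / 2) + ENNReal.ofReal (δ / 2) := by gcongr
    _ = _ := by rw [add_assoc, ← ENNReal.ofReal_add (by positivity) (by positivity), add_halves]

/-- An approximate `K`-isomorphism is bounded below, up to a small error and on finite sets, by a
joint embedding of objects of the inductive systems that approximate the finite sets. -/
theorem exists_joint_of_mem_apx (hK : K.NAP) {N M : K.KStructure} {ψ : Apx N.str M.str}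
    (hψ : ψ ∈ apx N M) (n₀ : ℕ) {F : Set N.str} {G : Set M.str} (hF : F.Finite) (hG : G.Finite)
    {δ : ℝ} (hδ : 0 < δ) :
    ∃ n ≥ n₀, ∃ m D, ∃ f ∈ K.Hom (N.system.obj n) D, ∃ g ∈ K.Hom (M.system.obj m) D,
      (∀ p ∈ F, ∃ a, dist (N.incl n a) p < δ) ∧ (∀ q ∈ G, ∃ b, dist (M.incl m b) q < δ) ∧
      ∀ p ∈ F, ∀ q ∈ G, ∀ a b, dist (N.incl n a) p < δ → dist (M.incl m b) q < δ →
        edist (f a) (g b) ≤ ψ p q + ENNReal.ofReal (4 * δ) := by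
  obtain ⟨n, m, D, f, hf, g, hg, H⟩ := exists_jointApx_le hK hψ hF hG hδ
  obtain ⟨n', hn', hF'⟩ := N.exists_near hF hδ (max n n₀)
  obtain ⟨m', hm', hG'⟩ := M.exists_near hG hδ m
  obtain ⟨D', f', hf', g', hg', H'⟩ := exists_joint_enlarge hK N M
    ((le_max_left _ _).trans hn') hm' hf hg hF hG hδ
  refine ⟨n', (le_max_right _ _).trans hn', m', D', f', hf', g', hg', hF' _ le_rfl, hG' _ le_rfl,
    fun p hp q hq a b ha hb => ?_⟩
  -- Each `δ` pays for one of: approximating `ψ`, enlarging the stages, replacing `p` by `a`,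
  -- replacing `q` by `b`.
  calc edist (f' a) (g' b) ≤ jointApx N M f' g' (N.incl n' a) (M.incl m' b) :=
        Apx.le_trivExt_map _ _ _ _ (Apx.ofJoint f' g' f'.isometry g'.isometry) a b
    _ ≤ edist (N.incl n' a) p + jointApx N M f' g' p q + edist q (M.incl m' b) :=
        Apx.apply_le _ _ _ _ _
    _ ≤ ENNReal.ofReal δ + (ψ p q + ENNReal.ofReal δ + ENNReal.ofReal δ) + ENNReal.ofReal δ := by
        refine add_le_add (add_le_add (edist_le_ofReal_of_dist_le ha.le) ?_)
          (edist_le_ofReal_of_dist_le (by rw [dist_comm]; exact hb.le))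
        exact (H' p hp q hq).trans (add_le_add (H p hp q hq) le_rfl)
    _ = ψ p q + (ENNReal.ofReal δ + ENNReal.ofReal δ + ENNReal.ofReal δ + ENNReal.ofReal δ) := by
        ring
    _ = _ := by
        rw [← ENNReal.ofReal_add hδ.le hδ.le, ← ENNReal.ofReal_add (by positivity) hδ.le,
          ← ENNReal.ofReal_add (by positivity) hδ.le]
        congr 2
        ring

/-! ### The distance `d^K` through joint embeddings -/

/-- Two tuples are `δ`-close in some joint embedding. -/
def Close {n : ℕ} (δ : ℝ) (p q : K.Pointed n) : Prop :=
  ∃ E, ∃ f ∈ K.Hom p.obj E, ∃ g ∈ K.Hom q.obj E, ∀ i, dist (f (p.tuple i)) (g (q.tuple i)) < δ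

theorem Close.symm {n : ℕ} {δ : ℝ} {p q : K.Pointed n} (h : Close δ p q) : Close δ q p := by
  obtain ⟨E, f, hf, g, hg, H⟩ := h
  exact ⟨E, g, hg, f, hf, fun i => by rw [dist_comm]; exact H i⟩

theorem Close.trans (hK : K.NAP) {n : ℕ} {δ₁ δ₂ δ : ℝ} {p q r : K.Pointed n} (h₁ : Close δ₁ p q)
    (h₂ : Close δ₂ q r) (hδ : δ₁ + δ₂ < δ) : Close δ p r := by
  obtain ⟨E₁, f₁, hf₁, g₁, hg₁, H₁⟩ := h₁
  obtain ⟨E₂, f₂, hf₂, g₂, hg₂, H₂⟩ := h₂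
  obtain ⟨E, k₁, hk₁, k₂, hk₂, H⟩ := hK _ _ _ g₁ hg₁ f₂ hf₂ (range q.tuple) (finite_range _)
    (δ - (δ₁ + δ₂)) (by linarith)
  refine ⟨E, k₁.comp f₁, K.comp_mem hk₁ hf₁, k₂.comp g₂, K.comp_mem hk₂ hg₂, fun i => ?_⟩
  change dist (k₁ (f₁ (p.tuple i))) (k₂ (g₂ (r.tuple i))) < δ
  have e1 := H₁ i
  rw [← k₁.isometry.dist_eq] at e1
  have e2 := H₂ i
  rw [← k₂.isometry.dist_eq] at e2
  have e3 := H _ ⟨i, rfl⟩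
  have := dist_triangle4 (k₁ (f₁ (p.tuple i))) (k₁ (g₁ (q.tuple i))) (k₂ (f₂ (q.tuple i)))
    (k₂ (g₂ (r.tuple i)))
  linarith

theorem Close.dK_le {n : ℕ} {δ : ℝ} {p q : K.Pointed n} (h : Close δ p q) :
    dK p q ≤ ENNReal.ofReal δ := by
  obtain ⟨E, f, hf, g, hg, H⟩ := h
  refine (iInf₂_le _ (jointApx_mem_apx (N := ofObj p.obj) (M := ofObj q.obj) (n := 0) (m := 0)
    hf hg)).trans (iSup_le fun i => ?_)
  refine (Apx.trivExt_le _ _ _ _ _ _ _ (p.tuple i) (q.tuple i)).trans ?_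
  change edist (p.tuple i) (p.tuple i) + edist (f (p.tuple i)) (g (q.tuple i)) +
    edist (q.tuple i) (q.tuple i) ≤ _
  rw [edist_self, edist_self, zero_add, add_zero]
  exact edist_le_ofReal_of_dist_le (H i).le

theorem close_of_dK_lt (hK : K.NAP) {n : ℕ} {δ : ℝ} {p q : K.Pointed n}
    (h : dK p q < ENNReal.ofReal δ) : Close δ p q := by
  simp only [dK, iInf_lt_iff] at h
  obtain ⟨φ, hφ, hlt⟩ := h
  have hδ : 0 < δ := ENNReal.ofReal_pos.1 (bot_le.trans_lt hlt)
  obtain ⟨r, hr0, hr, hr'⟩ := ENNReal.lt_iff_exists_real_btwn.1 hlt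
  have hr' := (ENNReal.ofReal_lt_ofReal_iff hδ).1 hr'
  -- The error is four times `(δ - r) / 5`, so the distances stay below `δ`.
  obtain ⟨_, -, _, D, f, hf, g, hg, -, -, H⟩ := exists_joint_of_mem_apx hK hφ 0
    (finite_range p.tuple) (finite_range q.tuple) (show 0 < (δ - r) / 5 by linarith)
  refine ⟨D, f, hf, g, hg, fun i => ?_⟩
  have h1 := H _ ⟨i, rfl⟩ _ ⟨i, rfl⟩ (p.tuple i) (q.tuple i)
    (by change dist (p.tuple i) (p.tuple i) < _; rw [dist_self]; linarith)
    (by change dist (q.tuple i) (q.tuple i) < _; rw [dist_self]; linarith)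
  have h2 : φ (p.tuple i) (q.tuple i) ≤ ENNReal.ofReal r :=
    (le_iSup (fun i => φ (p.tuple i) (q.tuple i)) i).trans hr.le
  have h3 := h1.trans (add_le_add h2 le_rfl)
  rw [← ENNReal.ofReal_add hr0 (by linarith), edist_dist,
    ENNReal.ofReal_le_ofReal_iff (by linarith)] at h3
  linarith

/-! ### Book-keeping -/

/-- The embeddings of an inductive system. -/
inductive InductiveSystem.Trans (S : K.InductiveSystem) (m : ℕ) :
    ∀ k : ℕ, Embedding (K.str (S.obj m)) (K.str (S.obj k)) → Prop
  | refl : S.Trans m m (Embedding.id _)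
  | step {k : ℕ} {e : Embedding (K.str (S.obj m)) (K.str (S.obj k))} (h : S.Trans m k e) :
      S.Trans m (k + 1) ((S.map k).comp e)

theorem InductiveSystem.Trans.incl_apply {M : K.KStructure} {m k : ℕ}
    {e : Embedding (K.str (M.system.obj m)) (K.str (M.system.obj k))}
    (h : M.system.Trans m k e) (a : K.str (M.system.obj m)) :
    M.incl k (e a) = M.incl m a := by
  induction h with
  | refl => rfl
  | step _ ih => exact (M.incl_map _ _).trans ih

variable (K) in
/-- An object together with objects embedded in it. -/
structure History where
  /-- the object -/
  obj : K.Obj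
  /-- the embedded objects -/
  past : ℕ → Σ A, {e : Embedding (K.str A) (K.str obj) // e ∈ K.Hom A obj}

/-- The composition of an embedding with one of a variable object. -/
def sigmaComp {B E : K.Obj} (e : {e : Embedding (K.str B) (K.str E) // e ∈ K.Hom B E})
    (p : Σ A, {f : Embedding (K.str A) (K.str B) // f ∈ K.Hom A B}) :
    Σ A, {f : Embedding (K.str A) (K.str E) // f ∈ K.Hom A E} :=
  ⟨p.1, e.1.comp p.2.1, K.comp_mem e.2 p.2.2⟩

/-- Push the embedded objects forward along an embedding, and add the new object itself from
the position `k` on. -/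
def History.push (s : K.History) (k : ℕ) (E : K.Obj)
    (e : {e : Embedding (K.str s.obj) (K.str E) // e ∈ K.Hom s.obj E}) : K.History :=
  ⟨E, fun m => if m < k then sigmaComp e (s.past m) else ⟨E, Embedding.id _, K.id_mem E⟩⟩

/-- If countably many tasks are given for every object, each of which can be accomplished at any
later time, then there is an inductive system in which all tasks are accomplished. -/
theorem exists_inductiveSystem (hne : Nonempty K.Obj)
    (Solved : ∀ (A : K.Obj), ℕ → ∀ E : K.Obj, Embedding (K.str A) (K.str E) → Prop)
    (hS : ∀ A n B, ∀ h ∈ K.Hom A B, ∃ E, ∃ e ∈ K.Hom B E, Solved A n E (e.comp h)) :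
    ∃ S : K.InductiveSystem, ∀ m n, ∃ k e, S.Trans m k e ∧ Solved (S.obj m) n (S.obj k) e := by
  obtain ⟨A₀⟩ := hne
  -- Time `k = pair (pair m n) l` is devoted to task `n` of the `m`-th object. Taking `l = m` below
  -- ensures `m ≤ k`, so that this object is already in the history.
  have step : ∀ (s : K.History) (k : ℕ), ∃ E, ∃ e : {e // e ∈ K.Hom s.obj E},
      Solved (s.past k.unpair.1.unpair.1).1 k.unpair.1.unpair.2 E
        (e.1.comp (s.past k.unpair.1.unpair.1).2.1) := fun s k => by
    obtain ⟨E, e, he, H⟩ := hS _ k.unpair.1.unpair.2 _ _ (s.past k.unpair.1.unpair.1).2.2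
    exact ⟨E, ⟨e, he⟩, H⟩
  choose E e he using step
  let hist : ℕ → K.History := Nat.rec ⟨A₀, fun _ => ⟨A₀, Embedding.id _, K.id_mem A₀⟩⟩
    fun k s => s.push (k + 1) (E s k) (e s k)
  let S : K.InductiveSystem :=
    ⟨fun k => (hist k).obj, fun k => (e (hist k) k).1, fun k => (e (hist k) k).2⟩
  have past : ∀ m k, m ≤ k → ∃ (t : Embedding (K.str (S.obj m)) (K.str (S.obj k)))
      (ht : t ∈ K.Hom (S.obj m) (S.obj k)),
      (hist k).past m = ⟨S.obj m, t, ht⟩ ∧ S.Trans m k t := by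
    intro m k hmk
    induction k, hmk using Nat.le_induction with
    | base =>
      refine ⟨Embedding.id _, K.id_mem _, ?_, .refl⟩
      cases m with
      | zero => rfl
      | succ m => exact if_neg (lt_irrefl _)
    | succ k hk ih =>
      obtain ⟨t, ht, h1, h2⟩ := ih
      refine ⟨(S.map k).comp t, K.comp_mem (S.map_mem k) ht, ?_, .step h2⟩
      refine (if_pos (Nat.lt_succ_of_le hk)).trans ?_
      exact congrArg (sigmaComp (e (hist k) k)) h1
  refine ⟨S, fun m n => ?_⟩
  let k := Nat.pair (Nat.pair m n) m
  obtain ⟨t, ht, h1, h2⟩ := past m k (Nat.right_le_pair _ _)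
  refine ⟨k + 1, _, .step h2, ?_⟩
  have h3 : ∀ p, (hist k).past m = p → Solved p.1 n (S.obj (k + 1)) ((S.map k).comp p.2.1) := by
    rintro _ rfl
    -- The type of the embedding depends on the index, so the decoded indices are replaced by
    -- substitution.
    have h4 : ∀ m' n', m' = m → n' = n → Solved ((hist k).past m').1 n' (S.obj (k + 1))
        ((S.map k).comp ((hist k).past m').2.1) → Solved ((hist k).past m).1 n (S.obj (k + 1))
        ((S.map k).comp ((hist k).past m).2.1) := by
      rintro _ _ rfl rfl h
      exact h
    exact h4 _ _ (by simp [k]) (by simp [k]) (he (hist k) k)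
  exact h3 _ h1

/-! ### Generic `K`-structures -/

/-- The extension property of a generic `K`-structure. -/
def KStructure.IsGeneric (M : K.KStructure) : Prop :=
  ∀ (m r s : ℕ) (p : K.Pointed r) (D : K.Obj), ∀ f ∈ K.Hom p.obj D,
    ∀ g ∈ K.Hom (M.system.obj m) D, ∀ (c : Fin s → K.str (M.system.obj m)) (δ : ℝ), 0 < δ →
      ∃ (p' : K.Pointed r) (k : ℕ), ∃ q ∈ K.Hom p'.obj (M.system.obj k), Close δ p p' ∧
        ∀ j i, dist (M.incl k (q (p'.tuple j))) (M.incl m (c i)) <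
          dist (f (p.tuple j)) (g (c i)) + δ

/-- An embedding of `p.obj` in `E` such that the distances between the tuples `p` and `c` are less
than `θ`. -/
def Realized {r s : ℕ} (p : K.Pointed r) (θ : Fin r → Fin s → ℚ) (E : K.Obj)
    (c : Fin s → K.str E) : Prop :=
  ∃ q ∈ K.Hom p.obj E, ∀ j i, dist (q (p.tuple j)) (c i) < θ j i

theorem exists_pos_add_lt {ι κ : Type*} [Finite ι] [Finite κ] {d t : ι → κ → ℝ}
    (h : ∀ j i, d j i < t j i) : ∃ δ : ℝ, 0 < δ ∧ ∀ j i, d j i + δ < t j i := by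
  have h1 : ∀ᶠ δ : ℝ in 𝓝[>] 0, ∀ j i, d j i + δ < t j i := by
    refine Filter.eventually_all.2 fun j => Filter.eventually_all.2 fun i => ?_
    refine nhdsWithin_le_nhds ((gt_mem_nhds (sub_pos.2 (h j i))).mono fun δ hδ => ?_)
    linarith
  obtain ⟨δ, h2, h3⟩ := (h1.and self_mem_nhdsWithin).exists
  exact ⟨δ, h3, h2⟩

/-- The bounds are strict, so the slack `δ` absorbs the error of amalgamating `F` with the later
object `B`. A task that is possible over `A` thus remains possible later. -/
theorem exists_realized (hK : K.NAP) {r s : ℕ} (p : K.Pointed r) (θ : Fin r → Fin s → ℚ)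
    {A B F : K.Obj} {h : Embedding (K.str A) (K.str B)} (hh : h ∈ K.Hom A B)
    {g : Embedding (K.str A) (K.str F)} (hg : g ∈ K.Hom A F) {c : Fin s → K.str A}
    (hr : Realized p θ F fun i => g (c i)) :
    ∃ E, ∃ e ∈ K.Hom B E, Realized p θ E fun i => e (h (c i)) := by
  obtain ⟨q, hq, H⟩ := hr
  obtain ⟨δ, hδ, hlt⟩ := exists_pos_add_lt H
  obtain ⟨E, e, he, k, hk, H'⟩ := hK _ _ _ h hh g hg (range c) (finite_range _) δ hδ
  refine ⟨E, e, he, k.comp q, K.comp_mem hk hq, fun j i => ?_⟩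
  change dist (k (q (p.tuple j))) (e (h (c i))) < _
  have h1 := H' _ ⟨i, rfl⟩
  rw [dist_comm] at h1
  have h2 := dist_triangle (k (q (p.tuple j))) (k (g (c i))) (e (h (c i)))
  rw [k.isometry.dist_eq] at h2
  linarith [hlt j i]

theorem exists_isGeneric (hne : Nonempty K.Obj) (hlim : K.HasInductiveLimits)
    (hK : K.IsFraisse) : ∃ M : K.KStructure, M.IsGeneric := by
  choose W hWc hW using hK.wpp
  have := hK.separable
  choose Q hQc hQ using fun A => TopologicalSpace.exists_countable_dense (K.str A)
  let T : K.Obj → Type _ := fun A => Σ r s : ℕ, W r × (Fin s → Q A) × (Fin r → Fin s → ℚ)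
  have hW' : ∀ r, Countable (W r) := fun r => (hWc r).to_subtype
  have hQ' : ∀ A, Countable (Q A) := fun A => (hQc A).to_subtype
  have hT : ∀ A, Countable (T A) := fun A => inferInstance
  choose code hcode using fun A => (countable_iff_exists_injective (T A)).1 (hT A)
  let Done (A : K.Obj) (t : T A) (E : K.Obj) (e : Embedding (K.str A) (K.str E)) : Prop :=
    Realized t.2.2.1.1 t.2.2.2.2 E fun i => e (t.2.2.2.1 i).1
  obtain ⟨S, hS⟩ := exists_inductiveSystem hne
    (fun A n E e => ∀ t : T A, code A t = n → (∃ F, ∃ g ∈ K.Hom A F, Done A t F g) →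
      Done A t E e) (fun A n B h hh => by
    -- Codes are injective, so `n` stands for at most one task. If there is none, or it cannot be
    -- realized, nothing is done.
    by_cases ht : ∃ t : T A, code A t = n ∧ ∃ F, ∃ g ∈ K.Hom A F, Done A t F g
    · obtain ⟨t, rfl, F, g, hg, hd⟩ := ht
      obtain ⟨E, e, he, H⟩ := exists_realized hK.nap _ _ hh hg hd
      refine ⟨E, e, he, fun t' ht' _ => ?_⟩
      rw [hcode A ht']
      exact H
    · refine ⟨B, Embedding.id _, K.id_mem B, fun t ht1 ht2 => absurd ⟨t, ht1, ht2⟩ ht⟩)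
  obtain ⟨M, rfl⟩ := hlim S
  refine ⟨M, fun m r s p D f hf g hg c δ hδ => ?_⟩
  obtain ⟨p', hp', hpp'⟩ := hW r p (ENNReal.ofReal (δ / 8)) (ENNReal.ofReal_pos.2 (by positivity))
  have hcl := close_of_dK_lt hK.nap hpp'
  obtain ⟨E, u, hu, v, hv, H⟩ := id hcl
  choose c' hc' hcc' using fun i => (hQ (M.system.obj m)).exists_dist_lt (c i)
    (show 0 < δ / 8 by positivity)
  obtain ⟨F, k₁, hk₁, k₂, hk₂, H'⟩ := hK.nap _ _ _ f hf u hu (range p.tuple) (finite_range _)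
    (δ / 8) (by positivity)
  -- Replacing `p` by `p'` and `c` by `c'` and amalgamating cost `3δ / 8 < δ / 2`, so the task is
  -- realizable. Returning from `c'` to `c` adds less than `δ / 8` to `θ < d + 3δ / 4`, which stays
  -- below `d + δ`.
  choose θ hθ1 hθ2 using fun j i => exists_rat_btwn
    (show dist (f (p.tuple j)) (g (c i)) + δ / 2 < dist (f (p.tuple j)) (g (c i)) + 3 * δ / 4 by
      linarith)
  obtain ⟨k, e, he, hd⟩ := hS m (code _ ⟨r, s, ⟨p', hp'⟩, fun i => ⟨c' i, hc' i⟩, θ⟩)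
  obtain ⟨q, hq, hq'⟩ := hd _ rfl ⟨F, k₁.comp g, K.comp_mem hk₁ hg, k₂.comp v, K.comp_mem hk₂ hv,
    fun j i => by
      change dist (k₂ (v (p'.tuple j))) (k₁ (g (c' i))) < θ j i
      have e1 := H j
      rw [← k₂.isometry.dist_eq, dist_comm] at e1
      have e2 := H' _ ⟨j, rfl⟩
      rw [dist_comm] at e2
      have e3 : dist (k₁ (f (p.tuple j))) (k₁ (g (c' i))) ≤
          dist (f (p.tuple j)) (g (c i)) + dist (c i) (c' i) := by
        rw [k₁.isometry.dist_eq, ← g.isometry.dist_eq (c i)]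
        exact dist_triangle _ _ _
      have := dist_triangle4 (k₂ (v (p'.tuple j))) (k₂ (u (p.tuple j))) (k₁ (f (p.tuple j)))
        (k₁ (g (c' i)))
      linarith [hθ1 j i, hcc' i]⟩
  obtain ⟨E', u', hu', v', hv', H''⟩ := hcl
  refine ⟨p', k, q, hq, ⟨E', u', hu', v', hv', fun i => (H'' i).trans (by linarith)⟩,
    fun j i => ?_⟩
  have e1 : dist (q (p'.tuple j)) (e (c' i)) < θ j i := hq' j i
  rw [← (M.incl k).isometry.dist_eq, he.incl_apply] at e1
  have e2 : dist (M.incl m (c i)) (M.incl m (c' i)) < δ / 8 := by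
    rw [(M.incl m).isometry.dist_eq]; exact hcc' i
  rw [dist_comm] at e2
  have := dist_triangle (M.incl k (q (p'.tuple j))) (M.incl m (c' i)) (M.incl m (c i))
  linarith [hθ2 j i]

/-- Genericity embeds only a tuple close to that of `A`. Amalgamating over its object `p'.obj`
brings `A` back; closeness and amalgamation together give `2 * δ`. -/
theorem KStructure.IsGeneric.exists_joint {M : K.KStructure} (hM : M.IsGeneric) (hK : K.NAP)
    {A D : K.Obj} {m : ℕ} {f : Embedding (K.str A) (K.str D)} (hf : f ∈ K.Hom A D)
    {g : Embedding (K.str (M.system.obj m)) (K.str D)} (hg : g ∈ K.Hom (M.system.obj m) D)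
    {S : Set (K.str A)} (hS : S.Finite) {T : Set (K.str (M.system.obj m))} (hT : T.Finite)
    {δ : ℝ} (hδ : 0 < δ) :
    ∃ k D', ∃ f' ∈ K.Hom A D', ∃ g' ∈ K.Hom (M.system.obj k) D', ∀ a ∈ S, ∃ z,
      dist (f' a) (g' z) < 2 * δ ∧
      ∀ c ∈ T, dist (M.incl k z) (M.incl m c) < dist (f a) (g c) + δ := by
  obtain ⟨S', hS', hSS', hgen⟩ := exists_finite_isGenerator A S hS
  obtain ⟨r, a, -, ha⟩ := hS'.fin_param
  obtain ⟨s, c, -, hc⟩ := hT.fin_param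
  obtain ⟨p', k, q, hq, ⟨E, u, hu, v, hv, H⟩, H'⟩ :=
    hM m r s ⟨A, a, by rw [ha]; exact hgen⟩ D f hf g hg c δ hδ
  obtain ⟨D', h₁, hh₁, h₂, hh₂, H₁⟩ := hK _ _ _ v hv q hq (range p'.tuple) (finite_range _) δ hδ
  refine ⟨k, D', h₁.comp u, K.comp_mem hh₁ hu, h₂, hh₂, fun x hx => ?_⟩
  obtain ⟨j, rfl⟩ : x ∈ range a := ha ▸ hSS' hx
  refine ⟨q (p'.tuple j), ?_, fun y hy => ?_⟩
  · change dist (h₁ (u (a j))) (h₂ (q (p'.tuple j))) < _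
    have e1 : dist (u (a j)) (v (p'.tuple j)) < δ := H j
    rw [← h₁.isometry.dist_eq] at e1
    have e2 := H₁ _ ⟨j, rfl⟩
    have := dist_triangle (h₁ (u (a j))) (h₁ (v (p'.tuple j))) (h₂ (q (p'.tuple j)))
    linarith
  · obtain ⟨i, rfl⟩ : y ∈ range c := hc ▸ hy
    exact H' j i

/-- A strict approximate `K`-isomorphism into a generic `K`-structure can be shrunk to one that is
almost total on a given finite set. -/
theorem KStructure.IsGeneric.exists_stx_le {M : K.KStructure} (hM : M.IsGeneric) (hK : K.NAP)
    {N : K.KStructure} {φ : Apx N.str M.str} (hφ : φ ∈ stx N M) {F : Set N.str} (hF : F.Finite)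
    {ε : ℝ} (hε : 0 < ε) :
    ∃ φ' ∈ stx N M, φ' ≤ φ ∧ ∀ p ∈ F, ∃ q, φ' p q ≤ ENNReal.ofReal ε := by
  obtain ⟨-, ψ, hψ, hlt⟩ := hφ
  obtain ⟨F₀, G₀, ε₀, hF₀, hG₀, hε₀, H⟩ := Apx.exists_of_strictlyDominates hlt
  -- Matching costs `3δ` and thickening `δ`. Comparison with `ψ` on `F₀ × G₀` costs `4δ + 2δ` more.
  obtain ⟨δ, hδ, hδε, hδε₀⟩ : ∃ δ > 0, 4 * δ ≤ ε ∧ 10 * δ ≤ ε₀ :=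
    ⟨min (ε / 4) (ε₀ / 10), by positivity, by linarith [min_le_left (ε / 4) (ε₀ / 10)],
      by linarith [min_le_right (ε / 4) (ε₀ / 10)]⟩
  obtain ⟨n, -, m, D, f, hf, g, hg, hF', hG', H'⟩ :=
    exists_joint_of_mem_apx hK hψ 0 (hF₀.union hF) hG₀ hδ
  obtain ⟨S, hS, hSF⟩ := (hF₀.union hF).exists_finite_witnesses hF'
  obtain ⟨T, hT, hTG⟩ := hG₀.exists_finite_witnesses hG'
  obtain ⟨k, D', f', hf', g', hg', H₁⟩ := hM.exists_joint hK hf hg hS hT hδ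
  obtain ⟨Z, hZ, hSZ⟩ := hS.exists_finite_witnesses H₁
  have hbound : ∀ p a z, dist (N.incl n a) p < δ → dist (f' a) (g' z) < 2 * δ → ∀ q,
      jointApx N M f' g' p q ≤ ENNReal.ofReal (3 * δ) + edist (M.incl k z) q := by
    intro p a z h1 h2 q
    refine (Apx.trivExt_le _ _ _ _ _ p q a z).trans ?_
    gcongr
    rw [show 3 * δ = δ + 2 * δ by ring, ENNReal.ofReal_add hδ.le (by positivity)]
    rw [dist_comm] at h1
    exact add_le_add (edist_le_ofReal_of_dist_le h1.le) (edist_le_ofReal_of_dist_le h2.le)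
  -- The thickening lies below `φ` because it is controlled on `F₀ × G₀`; the points `z` are added
  -- on the right so that it stays small at the new matches.
  refine ⟨_, thicken_mem_stx hK (jointApx_mem_apx hf' hg') (hF₀.union hF)
    (hG₀.union (hZ.image (M.incl k))) hδ, H _ fun p hp q hq => ?_, fun p hp => ?_⟩
  · refine (Apx.thicken_le _ _ (.inl hp) (.inl hq)).trans ?_
    obtain ⟨a, ha, hap⟩ := hSF p (.inl hp)
    obtain ⟨b, hb, hbq⟩ := hTG q hq
    obtain ⟨z, hz, h1, h2⟩ := hSZ a ha
    have e1 : edist (M.incl k z) q ≤ edist (f a) (g b) + ENNReal.ofReal (2 * δ) := by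
      refine edist_le_edist_add_ofReal (by positivity) ?_
      linarith [h2 b hb, dist_triangle (M.incl k z) (M.incl m b) q]
    calc jointApx N M f' g' p q + ENNReal.ofReal δ
        ≤ ENNReal.ofReal (3 * δ) + (ψ p q + ENNReal.ofReal (4 * δ) + ENNReal.ofReal (2 * δ)) +
            ENNReal.ofReal δ := by
          refine add_le_add ((hbound p a z hap h1 q).trans ?_) le_rfl
          refine add_le_add le_rfl (e1.trans (add_le_add ?_ le_rfl))
          exact H' p (.inl hp) q hq a b hap hbq
      _ = ψ p q + (ENNReal.ofReal (3 * δ) + ENNReal.ofReal (4 * δ) + ENNReal.ofReal (2 * δ) +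
            ENNReal.ofReal δ) := by ring
      _ ≤ ψ p q + ENNReal.ofReal ε₀ := by
          rw [← ENNReal.ofReal_add (by positivity) (by positivity),
            ← ENNReal.ofReal_add (by positivity) (by positivity),
            ← ENNReal.ofReal_add (by positivity) (by positivity)]
          gcongr
          linarith
  · obtain ⟨a, ha, hap⟩ := hSF p (.inr hp)
    obtain ⟨z, hz, h1, -⟩ := hSZ a ha
    refine ⟨M.incl k z, (Apx.thicken_le _ _ (.inr hp) (.inr (mem_image_of_mem _ hz))).trans ?_⟩
    refine (add_le_add (hbound p a z hap h1 _) le_rfl).trans ?_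
    rw [edist_self, add_zero, ← ENNReal.ofReal_add (by positivity) (by positivity)]
    exact ENNReal.ofReal_le_ofReal (by linarith)

/-- A countable dense subset of a `K`-structure, as an increasing union of finite sets. -/
theorem KStructure.exists_dense_iUnion_finite
    (hK : ∀ A : K.Obj, TopologicalSpace.SeparableSpace (K.str A)) (N : K.KStructure) :
    ∃ F : ℕ → Set N.str, (∀ n, (F n).Finite) ∧ Monotone F ∧ Dense (⋃ n, F n) := by
  have : TopologicalSpace.SeparableSpace N.str := by
    have h : TopologicalSpace.IsSeparable (⋃ n, range (N.incl n)) :=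
      .iUnion fun n => TopologicalSpace.isSeparable_range (N.incl n).isometry.continuous
    rw [← TopologicalSpace.isSeparable_univ_iff, ← N.dense_iUnion.closure_eq]
    exact h.closure
  obtain ⟨Q, hQ, hd⟩ := TopologicalSpace.exists_countable_dense N.str
  obtain ⟨c, hc⟩ := (countable_iff_exists_injective Q).1 hQ.to_subtype
  refine ⟨fun n => Subtype.val '' (c ⁻¹' Iic n),
    fun n => ((finite_Iic n).preimage hc.injOn).image _,
    fun n m h => image_mono (preimage_mono (Iic_subset_Iic.2 h)), hd.mono fun p hp => ?_⟩
  exact mem_iUnion.2 ⟨c ⟨p, hp⟩, ⟨p, hp⟩, le_refl (c ⟨p, hp⟩), rfl⟩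

end StructureCategory

/-! ### The limit isometry -/

/-- A decreasing sequence of approximate isometries that are ever more total on a dense set
converges to an isometry. -/
theorem Apx.exists_isometry_of_antitone {X Y : Type*} [MetricSpace X] [MetricSpace Y]
    [CompleteSpace Y] {φ : ℕ → Apx X Y} (hφ : Antitone φ) {F : ℕ → Set X} (hF : Monotone F)
    (hd : Dense (⋃ n, F n))
    (h : ∀ n, ∀ p ∈ F n, ∃ q, φ (n + 1) p q ≤ ENNReal.ofReal ((1 / 2) ^ n)) :
    ∃ ι : X → Y, Isometry ι ∧ ∀ p, ∀ ε > 0, ∃ n, φ n p (ι p) ≤ ε := by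
  have h0 : ∀ ε : ℝ≥0∞, 0 < ε → ∃ N, ∀ n ≥ N, ENNReal.ofReal ((1 / 2) ^ n) ≤ ε := by
    intro ε hε
    have : Filter.Tendsto (fun n : ℕ => ENNReal.ofReal ((1 / 2 : ℝ) ^ n)) Filter.atTop (𝓝 0) := by
      rw [← ENNReal.ofReal_zero]
      exact ENNReal.tendsto_ofReal
        (tendsto_pow_atTop_nhds_zero_of_lt_one (by norm_num) (by norm_num))
    exact Filter.eventually_atTop.1 (this.eventually_le_const hε)
  -- every point is almost matched
  have h1 : ∀ p, ∀ ε : ℝ≥0∞, 0 < ε → ∃ n q, φ n p q ≤ ε := by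
    intro p ε hε
    have hε2 : 0 < ε / 2 := ENNReal.half_pos hε.ne'
    obtain ⟨p', hp', hpp'⟩ := EMetric.mem_closure_iff.1 (hd p) (ε / 2) hε2
    obtain ⟨m, hm⟩ := mem_iUnion.1 hp'
    obtain ⟨N, hN⟩ := h0 (ε / 2) hε2
    obtain ⟨q, hq⟩ := h (max m N) p' (hF (le_max_left _ _) hm)
    refine ⟨max m N + 1, q, (((φ (max m N + 1)).2.1 q).1 p p').trans ?_⟩
    rw [← ENNReal.add_halves ε]
    exact add_le_add hpp'.le (hq.trans (hN _ (le_max_right _ _)))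
  have h2 : ∀ p, ∃ q, ∀ ε : ℝ≥0∞, 0 < ε → ∃ n, φ n p q ≤ ε := by
    intro p
    choose n q hq using fun k : ℕ => h1 p (ENNReal.ofReal ((1 / 2) ^ k))
      (ENNReal.ofReal_pos.2 (by positivity))
    -- Almost-matches of the same point are close by the Katetov inequality, once monotonicity has
    -- brought both to a common index.
    have hle : ∀ k l, edist (q k) (q l) ≤
        ENNReal.ofReal ((1 / 2) ^ k) + ENNReal.ofReal ((1 / 2) ^ l) := fun k l => by
      let m := max (n k) (n l)
      refine (((φ m).2.2 p).2 (q k) (q l)).trans (add_le_add ?_ ?_)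
      · exact (hφ (le_max_left _ _) p (q k)).trans (hq k)
      · exact (hφ (le_max_right _ _) p (q l)).trans (hq l)
    have hc : CauchySeq q := by
      refine EMetric.cauchySeq_iff.2 fun ε hε => ?_
      obtain ⟨ε', hε', hlt⟩ := exists_between hε
      obtain ⟨N, hN⟩ := h0 (ε' / 2) (ENNReal.half_pos hε'.ne')
      refine ⟨N, fun k hk l hl => ((hle k l).trans ?_).trans_lt hlt⟩
      rw [← ENNReal.add_halves ε']
      exact add_le_add (hN k hk) (hN l hl)
    obtain ⟨q', hq'⟩ := cauchySeq_tendsto_of_complete hc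
    refine ⟨q', fun ε hε => ?_⟩
    obtain ⟨N, hN⟩ := h0 (ε / 2) (ENNReal.half_pos hε.ne')
    obtain ⟨k, hk, hkN⟩ := (((EMetric.tendsto_nhds.1 hq') (ε / 2)
      (ENNReal.half_pos hε.ne')).and (Filter.eventually_ge_atTop N)).exists
    refine ⟨n k, (((φ (n k)).2.2 p).1 q' (q k)).trans ?_⟩
    rw [← ENNReal.add_halves ε, edist_comm]
    exact add_le_add hk.le ((hq k).trans (hN k hkN))
  choose ι hι using h2
  refine ⟨ι, fun p p' => ?_, hι⟩
  have h3 : ∀ ε : ℝ≥0∞, 0 < ε → ∃ n, φ n p (ι p) ≤ ε / 2 ∧ φ n p' (ι p') ≤ ε / 2 := by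
    intro ε hε
    obtain ⟨n, hn⟩ := hι p (ε / 2) (ENNReal.half_pos hε.ne')
    obtain ⟨n', hn'⟩ := hι p' (ε / 2) (ENNReal.half_pos hε.ne')
    exact ⟨max n n', (hφ (le_max_left _ _) _ _).trans hn, (hφ (le_max_right _ _) _ _).trans hn'⟩
  apply le_antisymm <;> refine ENNReal.le_of_forall_pos_le_add fun ε hε _ => ?_
  · obtain ⟨n, hn, hn'⟩ := h3 ε (by exact_mod_cast hε)
    calc edist (ι p) (ι p') ≤ φ n p (ι p) + φ n p (ι p') := ((φ n).2.2 p).2 _ _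
      _ ≤ ε / 2 + (edist p p' + ε / 2) :=
        add_le_add hn ((((φ n).2.1 _).1 p p').trans (add_le_add le_rfl hn'))
      _ = edist p p' + (ε / 2 + ε / 2) := by ring
      _ = edist p p' + ε := by rw [ENNReal.add_halves]
  · obtain ⟨n, hn, hn'⟩ := h3 ε (by exact_mod_cast hε)
    calc edist p p' ≤ φ n p (ι p) + φ n p' (ι p) := ((φ n).2.1 _).2 _ _
      _ ≤ ε / 2 + (edist (ι p) (ι p') + ε / 2) :=
        add_le_add hn ((((φ n).2.2 _).1 _ _).trans (add_le_add le_rfl hn'))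
      _ = edist (ι p) (ι p') + (ε / 2 + ε / 2) := by ring
      _ = edist (ι p) (ι p') + ε := by rw [ENNReal.add_halves]

/-! ### Preservation of the symbols -/

namespace StructureCategory

open LStructure

variable {L : FirstOrder.Language.{u, v}} {K : StructureCategory.{u, v, w, x} L}

theorem Close.refl {n : ℕ} {δ : ℝ} (hδ : 0 < δ) (p : K.Pointed n) : Close δ p p :=
  ⟨p.obj, Embedding.id _, K.id_mem _, Embedding.id _, K.id_mem _, fun i => by
    rw [dist_self]; exact hδ⟩

theorem Close.mono {n : ℕ} {δ δ' : ℝ} {p q : K.Pointed n} (h : Close δ p q) (hδ : δ ≤ δ') :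
    Close δ' p q := by
  obtain ⟨E, f, hf, g, hg, H⟩ := h
  exact ⟨E, f, hf, g, hg, fun i => (H i).trans_le hδ⟩

/-- Alternate between `p` and the terms of a sequence. -/
def interleave {n : ℕ} (p : K.Pointed n) (p' : ℕ → K.Pointed n) (k : ℕ) : K.Pointed n :=
  if Even k then p else p' k

theorem interleave_even {n : ℕ} (p : K.Pointed n) (p' : ℕ → K.Pointed n) (k : ℕ) :
    interleave p p' (2 * k) = p := if_pos (even_two_mul k)

theorem interleave_odd {n : ℕ} (p : K.Pointed n) (p' : ℕ → K.Pointed n) (k : ℕ) :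
    interleave p p' (2 * k + 1) = p' (2 * k + 1) :=
  if_neg (Nat.not_even_iff_odd.2 (odd_two_mul_add_one k))

theorem isCauchy_interleave (hK : K.NAP) {n : ℕ} {p : K.Pointed n} {p' : ℕ → K.Pointed n}
    (h : ∀ k : ℕ, Close (1 / ((k : ℝ) + 1)) p (p' k)) : IsCauchy (interleave p p') := by
  have h1 : ∀ k : ℕ, Close (1 / ((k : ℝ) + 1)) p (interleave p p' k) := fun k => by
    unfold interleave
    split_ifs
    · exact .refl (by positivity) p
    · exact h k
  intro ε hε
  obtain ⟨δ, -, hδ, hδε⟩ := ENNReal.lt_iff_exists_real_btwn.1 hε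
  have hδ := ENNReal.ofReal_pos.1 hδ
  obtain ⟨N, hN⟩ := exists_nat_one_div_lt (show 0 < δ / 3 by positivity)
  have h2 : ∀ k ≥ N, Close (δ / 3) p (interleave p p' k) := fun k hk =>
    (h1 k).mono ((Nat.one_div_le_one_div hk).trans hN.le)
  exact ⟨N, fun i hi j hj =>
    (((h2 i hi).symm.trans hK (h2 j hj) (by linarith : _ < δ)).dK_le).trans_lt hδε⟩

/-- The graph vanishes at `(p, ι p)`, so some joint embedding puts `a` near points `b` of a stage of
`M` that approximate its image. Genericity over `b` then yields a tuple inside `M`. -/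
theorem KStructure.IsGeneric.exists_close {M N : K.KStructure} (hM : M.IsGeneric) (hK : K.NAP)
    {ι : N.str → M.str} (hι : Isometry ι) (hmem : Apx.graph ι hι ∈ apx N M) {n r : ℕ}
    (a : Fin r → K.str (N.system.obj n))
    (ha : (K.str (N.system.obj n)).IsGenerator (range a)) {δ : ℝ} (hδ : 0 < δ) :
    ∃ (p : K.Pointed r) (e : Embedding (K.str p.obj) M.str), Close δ ⟨_, a, ha⟩ p ∧
      ∀ j, dist (e (p.tuple j)) (ι (N.incl n (a j))) < δ := by
  obtain ⟨n', hn', m, D, f, hf, g, hg, -, hG, H⟩ := exists_joint_of_mem_apx hK hmem n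
    (finite_range fun j => N.incl n (a j)) (finite_range fun j => ι (N.incl n (a j)))
    (show 0 < δ / 8 by positivity)
  obtain ⟨t, ht, ht'⟩ := N.exists_trans hn'
  choose b hb using fun j => hG _ ⟨j, rfl⟩
  have H' : ∀ j, dist (f (t (a j))) (g (b j)) ≤ 4 * (δ / 8) := fun j => by
    have h := H _ ⟨j, rfl⟩ _ ⟨j, rfl⟩ (t (a j)) (b j)
      (by dsimp only; rw [ht', dist_self]; positivity) (hb j)
    change _ ≤ edist (ι (N.incl n (a j))) (ι (N.incl n (a j))) + _ at h
    rw [edist_self, zero_add, edist_dist, ENNReal.ofReal_le_ofReal_iff (by positivity)] at h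
    exact h
  -- The errors are `4δ / 8` from the joint embedding, `δ / 8` from genericity and `δ / 8` from `b`.
  obtain ⟨p, k, q, -, hcl, hd⟩ := hM m r r ⟨_, a, ha⟩ D (f.comp t) (K.comp_mem hf ht) g hg b
    (δ / 8) (by positivity)
  refine ⟨p, (M.incl k).comp q, hcl.mono (by linarith), fun j => ?_⟩
  change dist (M.incl k (q (p.tuple j))) _ < _
  have h1 : _ < dist (f (t (a j))) (g (b j)) + δ / 8 := hd j j
  have h2 := hb j
  dsimp only at h2
  linarith [H' j, dist_triangle (M.incl k (q (p.tuple j))) (M.incl m (b j)) (ι (N.incl n (a j)))]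

/-- The sequence of approximations of a generating tuple. -/
theorem KStructure.IsGeneric.exists_seq {M N : K.KStructure} (hM : M.IsGeneric) (hK : K.NAP)
    {ι : N.str → M.str} (hι : Isometry ι) (hmem : Apx.graph ι hι ∈ apx N M) {n r : ℕ}
    (a : Fin r → K.str (N.system.obj n))
    (ha : (K.str (N.system.obj n)).IsGenerator (range a)) :
    ∃ (p : ℕ → K.Pointed r) (e : ∀ k, Embedding (K.str (p k).obj) M.str),
      IsCauchy (interleave ⟨_, a, ha⟩ p) ∧
      ∀ j, Filter.Tendsto (fun k => e (2 * k + 1) ((p (2 * k + 1)).tuple j)) Filter.atTop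
        (𝓝 (ι (N.incl n (a j)))) := by
  choose p e hcl hd using fun k : ℕ => hM.exists_close hK hι hmem a ha
    (show 0 < 1 / ((k : ℝ) + 1) by positivity)
  refine ⟨p, e, isCauchy_interleave hK hcl, fun j => ?_⟩
  have h1 : Filter.Tendsto (fun k => e k ((p k).tuple j)) Filter.atTop
      (𝓝 (ι (N.incl n (a j)))) :=
    tendsto_iff_dist_tendsto_zero.2 <| squeeze_zero (fun _ => dist_nonneg)
      (fun k => (hd k j).le) tendsto_one_div_add_atTop_nhds_zero_nat
  exact h1.comp (Filter.tendsto_atTop_mono (fun k => by dsimp only [id]; omega) Filter.tendsto_id)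

/-- By CCP the values of `R` along the interleaved sequence converge. The even terms are constantly
the value at `a`; the odd ones are computed in `M` and tend to the value at the image by continuity.
-/
theorem KStructure.IsGeneric.map_rel_incl {M N : K.KStructure} (hM : M.IsGeneric)
    (hK : K.IsFraisse) {ι : N.str → M.str} (hι : Isometry ι) (hmem : Apx.graph ι hι ∈ apx N M)
    {n r : ℕ} (R : L.Relations r) (a : Fin r → K.str (N.system.obj n)) :
    N.str.rel R (fun i => N.incl n (a i)) = M.str.rel R fun i => ι (N.incl n (a i)) := by
  -- CCP speaks of generating tuples, so a finite generator `b` is appended to `a`.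
  obtain ⟨S, hS, -, hgen⟩ := exists_finite_isGenerator (N.system.obj n) ∅ finite_empty
  obtain ⟨s, b, -, rfl⟩ := hS.fin_param
  obtain ⟨p, e, hc, he⟩ := hM.exists_seq hK.nap hι hmem (Fin.append a b)
    (hgen.mono (by rintro _ ⟨i, rfl⟩; exact ⟨Fin.natAdd r i, Fin.append_right _ _ _⟩))
  let val : K.Pointed (r + s) → ℝ := fun p =>
    (K.str p.obj).rel R fun i => p.tuple (Fin.castAdd s i)
  obtain ⟨l, hl⟩ := cauchySeq_tendsto_of_complete (hK.ccp.1 r s R _ hc)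
  have h1 := hl.comp (Filter.tendsto_atTop_mono (fun k => by dsimp only [id]; omega) Filter.tendsto_id :
    Filter.Tendsto (fun k : ℕ => 2 * k) Filter.atTop Filter.atTop)
  have h2 := hl.comp (Filter.tendsto_atTop_mono (fun k => by dsimp only [id]; omega) Filter.tendsto_id :
    Filter.Tendsto (fun k : ℕ => 2 * k + 1) Filter.atTop Filter.atTop)
  have e1 : l = N.str.rel R fun i => N.incl n (a i) := by
    refine tendsto_nhds_unique h1 (tendsto_const_nhds.congr fun k => ?_)
    refine Eq.trans ?_ (congrArg val (interleave_even _ p k)).symm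
    simp only [val, Fin.append_left]
    exact ((N.incl n).map_rel R a).symm
  have e2 : l = M.str.rel R fun i => ι (N.incl n (a i)) := by
    refine tendsto_nhds_unique h2 (Filter.Tendsto.congr (f₁ := fun k =>
      M.str.rel R fun i => e (2 * k + 1) ((p (2 * k + 1)).tuple (Fin.castAdd s i)))
      (fun k => ?_) ?_)
    · refine Eq.trans ?_ (congrArg val (interleave_odd _ p k)).symm
      exact ((e _).map_rel R _).symm
    · refine ((M.str.continuous_rel R).tendsto _).comp (tendsto_pi_nhds.2 fun i => ?_)
      have := he (Fin.castAdd s i)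
      rwa [Fin.append_left] at this
  rw [← e1, e2]

/-- The value `f(a)` is made an entry `j` of the generator. By CCP the interleaved sequence stays
Cauchy with the value of `f` appended. In the even terms entry `j` and the appended entry coincide,
so in the odd terms they become arbitrarily close. -/
theorem KStructure.IsGeneric.map_fn_incl {M N : K.KStructure} (hM : M.IsGeneric)
    (hK : K.IsFraisse) {ι : N.str → M.str} (hι : Isometry ι) (hmem : Apx.graph ι hι ∈ apx N M)
    {n r : ℕ} (f : L.Functions r) (a : Fin r → K.str (N.system.obj n)) :
    ι (N.str.fn f fun i => N.incl n (a i)) = M.str.fn f fun i => ι (N.incl n (a i)) := by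
  obtain ⟨S, hS, hfS, hgen⟩ := exists_finite_isGenerator (N.system.obj n)
    {(K.str (N.system.obj n)).fn f a} (finite_singleton _)
  obtain ⟨s, b, -, rfl⟩ := hS.fin_param
  obtain ⟨j, hj⟩ := hfS rfl
  have hgen' : (K.str (N.system.obj n)).IsGenerator (range (Fin.append a b)) :=
    hgen.mono (by rintro _ ⟨i, rfl⟩; exact ⟨Fin.natAdd r i, Fin.append_right _ _ _⟩)
  obtain ⟨p, e, hc, he⟩ := hM.exists_seq hK.nap hι hmem (Fin.append a b) hgen'
  have hc' := hK.ccp.2 r s f _ hc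
  have h1 : Filter.Tendsto (fun k => e (2 * k + 1) ((p (2 * k + 1)).tuple (Fin.natAdd r j)))
      Filter.atTop (𝓝 (ι (N.str.fn f fun i => N.incl n (a i)))) := by
    have := he (Fin.natAdd r j)
    rwa [Fin.append_right, hj, (N.incl n).map_fn] at this
  have h2 : Filter.Tendsto (fun k => M.str.fn f fun i =>
      e (2 * k + 1) ((p (2 * k + 1)).tuple (Fin.castAdd s i))) Filter.atTop
      (𝓝 (M.str.fn f fun i => ι (N.incl n (a i)))) := by
    refine ((M.str.continuous_fn f).tendsto _).comp (tendsto_pi_nhds.2 fun i => ?_)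
    have := he (Fin.castAdd s i)
    rwa [Fin.append_left] at this
  have h3 : Filter.Tendsto (fun k => dist
      (e (2 * k + 1) ((p (2 * k + 1)).tuple (Fin.natAdd r j)))
      (M.str.fn f fun i => e (2 * k + 1) ((p (2 * k + 1)).tuple (Fin.castAdd s i))))
      Filter.atTop (𝓝 0) := by
    refine Metric.tendsto_atTop.2 fun ε hε => ?_
    obtain ⟨k₀, hk₀⟩ := hc' (ENNReal.ofReal (ε / 2)) (ENNReal.ofReal_pos.2 (by positivity))
    refine ⟨k₀, fun k hk => ?_⟩
    have h := close_of_dK_lt hK.nap (hk₀ (2 * k) (by omega) (2 * k + 1) (by omega))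
    dsimp only at h
    rw [interleave_even, interleave_odd] at h
    obtain ⟨E, u, -, v, -, H⟩ := h
    have H1 := H (Fin.natAdd r j).castSucc
    have H2 := H (Fin.last _)
    simp only [Pointed.snocFn, Fin.snoc_castSucc, Fin.snoc_last, Fin.append_right,
      Fin.append_left] at H1 H2
    rw [Real.dist_0_eq_abs, abs_of_nonneg dist_nonneg, ← (e _).map_fn, (e _).isometry.dist_eq]
    rw [hj, dist_comm] at H1
    refine (v.isometry.dist_eq _ _).symm.trans_lt ((dist_triangle _ _ _).trans_lt ((add_lt_add H1 H2).trans_le ?_))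
    rw [add_halves]
  exact dist_eq_zero.1 (tendsto_nhds_unique (h1.dist h2) h3)

theorem KStructure.dense_setOf_incl (N : K.KStructure) (r : ℕ) :
    Dense {a : Fin r → N.str | ∃ (n : ℕ) (b : Fin r → K.str (N.system.obj n)),
    a = fun i => N.incl n (b i)} := by
  refine Metric.dense_iff.2 fun a ε hε => ?_
  obtain ⟨n, -, hn⟩ := N.exists_near (finite_range a) hε 0
  choose b hb using fun i => hn n le_rfl _ ⟨i, rfl⟩
  exact ⟨fun i => N.incl n (b i), (dist_pi_lt_iff hε).2 hb, n, b, rfl⟩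

/-- An isometry into a generic `K`-structure whose graph is an approximate `K`-isomorphism is an
`L`-embedding. -/
def KStructure.IsGeneric.embedding {M N : K.KStructure} (hM : M.IsGeneric) (hK : K.IsFraisse)
    {ι : N.str → M.str} (hι : Isometry ι) (hmem : Apx.graph ι hι ∈ apx N M) :
    Embedding N.str M.str where
  toFun := ι
  isometry := hι
  map_rel {r} R := congrFun <| Continuous.ext_on (N.dense_setOf_incl r)
    (N.str.continuous_rel R) ((M.str.continuous_rel R).comp
      (continuous_pi fun i => hι.continuous.comp (continuous_apply i))) (by
      rintro _ ⟨n, b, rfl⟩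
      exact hM.map_rel_incl hK hι hmem R b)
  map_fn {r} f := congrFun <| Continuous.ext_on (N.dense_setOf_incl r)
    (hι.continuous.comp (N.str.continuous_fn f)) ((M.str.continuous_fn f).comp
      (continuous_pi fun i => hι.continuous.comp (continuous_apply i))) (by
      rintro _ ⟨n, b, rfl⟩
      exact hM.map_fn_incl hK hι hmem f b)

/-! ### Generic structures are Fraïssé limits -/

/-- On a finite set `φ n p (ι p)` is uniformly small for large `n`, and `φ n p q ≤ φ n p (ι p) + d
(ι p, q)`. So a member of `Apx_K` lies below the graph up to a small error. -/
theorem graph_mem_apx (hK : K.NAP) {N M : K.KStructure} {φ : ℕ → Apx N.str M.str}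
    (hφ : Antitone φ) (hmem : ∀ n, φ n ∈ apx N M) {ι : N.str → M.str} (hι : Isometry ι)
    (h : ∀ p, ∀ ε > 0, ∃ n, φ n p (ι p) ≤ ε) : Apx.graph ι hι ∈ apx N M := by
  refine mem_apx_of_joint fun F G ε hF hG hε => ?_
  have h1 : ∀ᶠ n in Filter.atTop, ∀ p ∈ F, φ n p (ι p) ≤ ENNReal.ofReal (ε / 2) := by
    refine (Filter.eventually_all_finite hF).2 fun p _ => ?_
    obtain ⟨n, hn⟩ := h p (ENNReal.ofReal (ε / 2)) (ENNReal.ofReal_pos.2 (by positivity))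
    exact (Filter.eventually_ge_atTop n).mono fun k hk => (hφ hk p (ι p)).trans hn
  obtain ⟨n, hn⟩ := h1.exists
  obtain ⟨k, m, D, f, hf, g, hg, H⟩ := exists_jointApx_le hK (hmem n) hF hG (half_pos hε)
  refine ⟨k, m, D, f, hf, g, hg, fun p hp q hq => (H p hp q hq).trans ?_⟩
  calc φ n p q + ENNReal.ofReal (ε / 2)
      ≤ edist p p + φ n p (ι p) + edist (ι p) q + ENNReal.ofReal (ε / 2) :=
        add_le_add (Apx.apply_le _ _ _ _ _) le_rfl
    _ ≤ ENNReal.ofReal (ε / 2) + edist (ι p) q + ENNReal.ofReal (ε / 2) := by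
        rw [edist_self, zero_add]
        gcongr
        exact hn p hp
    _ = edist (ι p) q + (ENNReal.ofReal (ε / 2) + ENNReal.ofReal (ε / 2)) := by ring
    _ = edist (ι p) q + ENNReal.ofReal ε := by
        rw [← ENNReal.ofReal_add (by positivity) (by positivity), add_halves]

theorem KStructure.IsGeneric.isFraisseLimit {M : K.KStructure} (hM : M.IsGeneric)
    (hK : K.IsFraisse) : IsFraisseLimit M := by
  rintro N φ ⟨-, ψ, hψ, hlt⟩
  obtain ⟨F₀, G₀, ε, hF₀, hG₀, hε, H⟩ := Apx.exists_of_strictlyDominates hlt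
  obtain ⟨F, hF, hFm, hFd⟩ := N.exists_dense_iUnion_finite hK.separable
  have step : ∀ (n : ℕ) (χ : stx N M), ∃ χ' : stx N M, χ'.1 ≤ χ.1 ∧
      ∀ p ∈ F n, ∃ q, χ'.1 p q ≤ ENNReal.ofReal ((1 / 2) ^ n) := fun n χ => by
    obtain ⟨χ', h1, h2, h3⟩ := hM.exists_stx_le hK.nap χ.2 (hF n)
      (show (0 : ℝ) < (1 / 2) ^ n by positivity)
    exact ⟨⟨χ', h1⟩, h2, h3⟩
  choose next hnext htot using step
  -- Starting from the thickening of `ψ` by `ε / 2`, rather than from `φ`, leaves the other `ε / 2`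
  -- as room around the limit graph for strict domination.
  let χ : ℕ → stx N M := Nat.rec ⟨_, thicken_mem_stx hK.nap hψ hF₀ hG₀ (half_pos hε)⟩ next
  have hanti : Antitone fun n => (χ n).1 := antitone_nat_of_succ_le fun n => hnext n (χ n)
  obtain ⟨ι, hι, hlim⟩ := Apx.exists_isometry_of_antitone hanti hFm hFd fun n => htot n (χ n)
  have hmem := graph_mem_apx hK.nap hanti (fun n => (χ n).2.1) hι hlim
  refine ⟨hM.embedding hK hι hmem, hmem, Apx.strictlyDominates_of hF₀ hG₀ (half_pos hε)
    fun ξ hξ => H ξ fun p hp q hq => (hξ p hp q hq).trans ?_⟩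
  have hle : edist (ι p) q ≤ ψ p q + ENNReal.ofReal (ε / 2) := by
    refine le_trans ?_ (Apx.thicken_le ψ _ hp hq)
    refine ENNReal.le_of_forall_pos_le_add fun δ hδ _ => ?_
    obtain ⟨n, hn⟩ := hlim p δ (by exact_mod_cast hδ)
    calc edist (ι p) q ≤ (χ n).1 p (ι p) + (χ n).1 p q := ((χ n).1.2.2 p).2 _ _
      _ ≤ δ + (χ 0).1 p q := add_le_add hn (hanti (Nat.zero_le n) p q)
      _ = (χ 0).1 p q + δ := add_comm _ _
  refine (add_le_add hle le_rfl).trans ?_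
  rw [add_assoc, ← ENNReal.ofReal_add (by positivity) (by positivity), add_halves]

end StructureCategory

theorem mainTheorem2 {L : FirstOrder.Language.{u, v}} (K : StructureCategory.{u, v, w, x} L)
    (hne : Nonempty K.Obj) (hlim : K.HasInductiveLimits) (hK : K.IsFraisse) :
    ∃ M : K.KStructure, StructureCategory.IsFraisseLimit M := by
  obtain ⟨M, hM⟩ := StructureCategory.exists_isGeneric hne hlim hK
  exact ⟨M, hM.isFraisseLimit hK⟩
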